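/- Let $L>0$ and $T>0$, and let $y_0,y_T\in C^1([0,L])$. There exists a constant $C>0$, which may depend on $L,T,y_0,y_T$ but not on $\alpha$, such that for every $\alpha>0$ there are a control $p^\alpha\in C^0([0,T])$, boundary controls $(v_l^\alpha,v_r^\alpha)\in C^1([0,T];\mathbb{R}^2)$ and a state $(y^\alpha,z^\alpha)\in C^1([0,T]\times[0,L];\mathbb{R}^2)$, with $z^\alpha(t,\cdot)$ twice continuously differentiable on $(0,L)$ for each $t\in(0,T)$, which satisfy (omitting the superscript $\alpha$ on $y,z,p,v_l,v_r$) the inviscid Burgers-$\alpha$ system $$ \begin{cases} y_t+z\,y_x=p(t) & \text{in }(0,T)\times(0,L),\\ z-\alpha^2 z_{xx}=y & \text{in }(0,T)\times(0,L),\\ z(\cdot,0)=y(\cdot,0)=v_l & \text{in }(0,T),\\ z(\cdot,L)=y(\cdot,L)=v_r & \text{in }(0,T),\\ y(0,\cdot)=y_0 & \text{in }(0,L), \end{cases} $$ the terminal condition $y^\alpha(T,\cdot)=y_T$ in $(0,L)$, and the uniform estimate $$ \|(z^\alpha,y^\alpha)\|_{C^1([0,T]\times[0,L];\mathbb{R}^2)}+\|p^\alpha\|_{C^0([0,T])}+\|(v_l^\alpha,v_r^\alpha)\|_{C^1([0,T];\mathbb{R}^2)}\le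 C . $$ -/

import Mathlib

open Set
open scoped ENNReal

/-- The `C⁰` norm `sup_{x ∈ s} ‖f x‖` of `f` on `s`, as an extended nonnegative number. -/
noncomputable def c0Norm {E F : Type*} [NormedAddCommGroup F] (s : Set E) (f : E → F) : ℝ≥0∞ :=
  ⨆ x ∈ s, ‖f x‖ₑ

/-- The `C¹` norm `sup_{x ∈ s} ‖f x‖ + sup_{x ∈ s} ‖Df x‖` of `f` on `s`
(meaningful for `f` of class `C¹` on a set `s` of unique differentiability, such as `[0,T]` or
`[0,T] × [0,L]`). -/
noncomputable def c1Norm {E F : Type*} [NormedAddCommGroup E] [NormedSpace ℝ E]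
    [NormedAddCommGroup F] [NormedSpace ℝ F] (s : Set E) (f : E → F) : ℝ≥0∞ :=
  c0Norm s f + c0Norm s (fderivWithin ℝ f s)

/-- `(y, z)`, functions of `(t, x)`, is a classical solution of the inviscid Burgers-α system on
`(0,T) × (0,L)` with distributed control `p`, boundary controls `vl`, `vr` and initial state `y₀`.
The class `C¹([0,T] × [0,L])` of the state is part of the notion, so that `y_t` and `y_x` exist;
for `z_xx` the `C²` regularity of `z(t, ·)` is recorded separately. -/
structure IsBurgersAlphaSolution (α L T : ℝ) (y₀ : ℝ → ℝ) (p vl vr : ℝ → ℝ)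
    (y z : ℝ × ℝ → ℝ) : Prop where
  y_contDiffOn : ContDiffOn ℝ 1 y (Icc 0 T ×ˢ Icc 0 L)
  z_contDiffOn : ContDiffOn ℝ 1 z (Icc 0 T ×ˢ Icc 0 L)
  z_contDiffOn_two : ∀ t ∈ Ioo 0 T, ContDiffOn ℝ 2 (fun x => z (t, x)) (Ioo 0 L)
  transport : ∀ t ∈ Ioo 0 T, ∀ x ∈ Ioo 0 L,
    deriv (fun s => y (s, x)) t + z (t, x) * deriv (fun ξ => y (t, ξ)) x = p t
  filter : ∀ t ∈ Ioo 0 T, ∀ x ∈ Ioo 0 L,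
    z (t, x) - α ^ 2 * deriv (deriv (fun ξ => z (t, ξ))) x = y (t, x)
  left : ∀ t ∈ Ioo 0 T, z (t, 0) = vl t ∧ y (t, 0) = vl t
  right : ∀ t ∈ Ioo 0 T, z (t, L) = vr t ∧ y (t, L) = vr t
  initial : ∀ x ∈ Ioo 0 L, y (0, x) = y₀ x

/-! The proof is a return-method argument: a strong drift, uniform in space, flushes the old state
out and brings the new one in. Fix `lam t = c * t * (T - t)`, take `p = lam'`, and look for `y = lam
+ U`. Constants pass unchanged through the filter with Dirichlet data, so `z = lam + Z` with `Z` the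
filter of `U`, and the system reduces to the pure transport equation `U_t + (lam + Z) U_x = 0`.

Extend `y₀` and `yT` to `f₀` and `f₁`, with `f₀` vanishing left of `-1` and `f₁` right of `L + 1`.
Along the flow `φ` of the velocity, `U = f₀ (φ t x 0) + f₁ (φ t x T)` solves the transport equation.
For `c` large, `f₀` has left `[0, L]` by a short time `τ` and `f₁` enters only after `T - τ`. So the
two never meet there, `U` takes the prescribed values at both ends, and estimates are needed only
over times of length `τ`.

The velocity depends on `U`, so `U` comes from Banach's fixed point theorem
(`exists_fixed_profile`). Uniformity in `α` comes from the maximum principle: the filter increases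
neither the sup norm (`abs_dirichletFilter_le`) nor the Lipschitz constant
(`abs_dirichletFilter_apply_sub_le`). Hence `τ`, `c` and every bound depend only on `L`, `T` and the
size `m` of the profiles. -/

open Filter Topology BoundedContinuousFunction

/-! ### Calculus preliminaries: Grönwall estimates, Lipschitz bounds and `C¹` norms, extension of
the data. -/

/-- A function of two real variables with continuous partial derivatives is of class `C¹`. -/
lemma contDiff_one_of_partial_derivs {f f₁ f₂ : ℝ → ℝ → ℝ}
    (h₁ : ∀ t x, HasDerivAt (fun s => f s x) (f₁ t x) t)
    (h₂ : ∀ t x, HasDerivAt (f t) (f₂ t x) x)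
    (c₁ : Continuous fun q : ℝ × ℝ => f₁ q.1 q.2)
    (c₂ : Continuous fun q : ℝ × ℝ => f₂ q.1 q.2) :
    ContDiff ℝ 1 fun q : ℝ × ℝ => f q.1 q.2 := by
  rw [contDiff_one_iff_hasFDerivAt]
  have c₁' : Continuous fun q : ℝ × ℝ => ContinuousLinearMap.toSpanSingleton ℝ (f₁ q.1 q.2) :=
    (ContinuousLinearMap.toSpanSingletonCLE (𝕜 := ℝ) (E := ℝ)).continuous.comp c₁
  have c₂' : Continuous fun q : ℝ × ℝ => ContinuousLinearMap.toSpanSingleton ℝ (f₂ q.1 q.2) :=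
    (ContinuousLinearMap.toSpanSingletonCLE (𝕜 := ℝ) (E := ℝ)).continuous.comp c₂
  refine ⟨fun q => (ContinuousLinearMap.toSpanSingleton ℝ (f₁ q.1 q.2)).coprod
    (ContinuousLinearMap.toSpanSingleton ℝ (f₂ q.1 q.2)), ?_, fun q => ?_⟩
  · have h := (c₁'.clm_comp (continuous_const (y := ContinuousLinearMap.fst ℝ ℝ ℝ))).add
      (c₂'.clm_comp (continuous_const (y := ContinuousLinearMap.snd ℝ ℝ ℝ)))
    refine h.congr fun q => ?_
    ext <;> simp
  · exact (hasStrictFDerivAt_uncurry_coprod (f := f)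
      (f₁ := fun t x => ContinuousLinearMap.toSpanSingleton ℝ (f₁ t x))
      (f₂ := fun t x => ContinuousLinearMap.toSpanSingleton ℝ (f₂ t x))
      (Eventually.of_forall fun v => (h₁ v.1 v.2).hasFDerivAt)
      (Eventually.of_forall fun v => (h₂ v.1 v.2).hasFDerivAt)
      c₁'.continuousAt c₂'.continuousAt).hasFDerivAt

/-- Grönwall's inequality on an interval with endpoints in either order. -/
lemma abs_le_gronwallBound_of_hasDerivAt {h h' : ℝ → ℝ} {a b K ε : ℝ}
    (hd : ∀ s, HasDerivAt h (h' s) s) (bound : ∀ s ∈ uIcc a b, |h' s| ≤ K * |h s| + ε) :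
    |h b| ≤ gronwallBound |h a| (|b - a| * K) (|b - a| * ε) 1 := by
  have hd' : ∀ θ : ℝ, HasDerivAt (fun θ => h (a + θ * (b - a)))
      (h' (a + θ * (b - a)) * (b - a)) θ := fun θ => by
    have h1 : HasDerivAt (fun θ : ℝ => a + θ * (b - a)) (b - a) θ := by
      simpa using ((hasDerivAt_id θ).mul_const (b - a)).const_add a
    exact (hd (a + θ * (b - a))).comp θ h1
  have key := norm_le_gronwallBound_of_norm_deriv_right_le (δ := |h a|) (a := 0) (b := 1)
    (K := |b - a| * K) (ε := |b - a| * ε)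
    (f := fun θ : ℝ => h (a + θ * (b - a))) (f' := fun θ => h' (a + θ * (b - a)) * (b - a))
    (fun θ _ => (hd' θ).continuousAt.continuousWithinAt) (fun θ _ => (hd' θ).hasDerivWithinAt)
    (by simp) (fun θ hθ => by
      have hmem : a + θ * (b - a) ∈ uIcc a b := by
        rw [← segment_eq_uIcc, segment_eq_image']
        exact ⟨θ, ⟨hθ.1, hθ.2.le⟩, by simp⟩
      have := bound _ hmem
      rw [Real.norm_eq_abs, Real.norm_eq_abs, abs_mul]
      nlinarith [abs_nonneg (b - a)]) 1 (by simp)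
  simpa using key

lemma abs_le_mul_exp_of_hasDerivAt {h h' : ℝ → ℝ} {a b K : ℝ}
    (hd : ∀ s, HasDerivAt h (h' s) s) (bound : ∀ s ∈ uIcc a b, |h' s| ≤ K * |h s|) :
    |h b| ≤ |h a| * Real.exp (|b - a| * K) := by
  have := abs_le_gronwallBound_of_hasDerivAt (ε := 0) hd (fun s hs => by simpa using bound s hs)
  simpa [gronwallBound_ε0] using this

/-- For `0 ≤ u ≤ 1` one has `exp u - 1 ≤ u + u ^ 2 ≤ 2 * u`, which makes the Grönwall bound linear
in the elapsed time. -/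
lemma abs_le_two_mul_of_hasDerivAt {h h' : ℝ → ℝ} {a b K ε : ℝ} (hK : 0 < K) (hε : 0 ≤ ε)
    (hab : |b - a| * K ≤ 1) (h0 : h a = 0)
    (hd : ∀ s, HasDerivAt h (h' s) s) (bound : ∀ s ∈ uIcc a b, |h' s| ≤ K * |h s| + ε) :
    |h b| ≤ 2 * (|b - a| * ε) := by
  rcases eq_or_ne a b with rfl | hne
  · simp [h0]
  have hba : 0 < |b - a| := abs_pos.2 (sub_ne_zero.2 hne.symm)
  have hpos : 0 < |b - a| * K := by positivity
  refine (abs_le_gronwallBound_of_hasDerivAt hd bound).trans ?_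
  rw [h0, abs_zero, gronwallBound_of_K_ne_0 hpos.ne']
  have he := Real.abs_exp_sub_one_sub_id_le (x := |b - a| * K) (by rwa [abs_of_pos hpos])
  have he' : Real.exp (|b - a| * K) - 1 ≤ 2 * (|b - a| * K) := by
    nlinarith [(abs_le.1 he).2]
  simp only [zero_mul, mul_one, zero_add]
  calc |b - a| * ε / (|b - a| * K) * (Real.exp (|b - a| * K) - 1)
      ≤ |b - a| * ε / (|b - a| * K) * (2 * (|b - a| * K)) := by gcongr
    _ = 2 * (|b - a| * ε) := by field_simp

lemma abs_sub_le_of_hasDerivAt_of_abs_le {f f' : ℝ → ℝ} {s : Set ℝ} {C : ℝ} (hs : Convex ℝ s)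
    (hd : ∀ x ∈ s, HasDerivAt f (f' x) x) (hC : ∀ x ∈ s, |f' x| ≤ C) {x y : ℝ} (hx : x ∈ s)
    (hy : y ∈ s) : |f x - f y| ≤ C * |x - y| :=
  hs.norm_image_sub_le_of_norm_hasDerivWithin_le (f' := f')
    (fun z hz => (hd z hz).hasDerivWithinAt) hC hy hx

/-- Difference quotients give the bound at interior points; continuity of `f'` carries it to the
endpoints. -/
lemma abs_deriv_le_of_abs_sub_le {L M : ℝ} (hL : 0 < L) {f f' : ℝ → ℝ}
    (hd : ∀ x, HasDerivAt f (f' x) x) (hc : Continuous f')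
    (hM : ∀ x ∈ Icc 0 L, ∀ y ∈ Icc 0 L, |f x - f y| ≤ M * |x - y|) {x : ℝ}
    (hx : x ∈ Icc 0 L) : |f' x| ≤ M := by
  have hM0 : 0 ≤ M := by
    have := (abs_nonneg _).trans (hM L (right_mem_Icc.2 hL.le) 0 (left_mem_Icc.2 hL.le))
    rw [sub_zero, abs_of_pos hL] at this
    exact nonneg_of_mul_nonneg_left this hL
  have hcl : IsClosed {x | |f' x| ≤ M} := isClosed_le hc.abs continuous_const
  have hint : Ioo 0 L ⊆ {x | |f' x| ≤ M} := fun y hy =>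
    (hd y).le_of_lip' hM0 <| by
      filter_upwards [Icc_mem_nhds hy.1 hy.2] with s hs
      exact hM s hs y (Ioo_subset_Icc_self hy)
  exact hcl.closure_subset_iff.2 hint (by rwa [closure_Ioo hL.ne])

/-- Reduces the final estimate to sup and Lipschitz bounds, which the maximum principle supplies
directly. The hypothesis `hs` lets the derivative bound pass from the interior to the boundary. -/
lemma c1Norm_le_of_lipschitz {E F : Type*} [NormedAddCommGroup E] [NormedSpace ℝ E]
    [NormedAddCommGroup F] [NormedSpace ℝ F] {s : Set E} {f : E → F} {a b : ℝ}
    (hs : s ⊆ closure (interior s)) (hu : UniqueDiffOn ℝ s) (hf : ContDiff ℝ 1 f)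
    (ha0 : 0 ≤ a) (hb0 : 0 ≤ b)
    (ha : ∀ x ∈ s, ‖f x‖ ≤ a) (hb : ∀ x ∈ s, ∀ y ∈ s, ‖f x - f y‖ ≤ b * ‖x - y‖) :
    c1Norm s f ≤ ENNReal.ofReal (a + b) := by
  rw [c1Norm, ENNReal.ofReal_add ha0 hb0]
  have hder : ∀ x ∈ s, ‖fderiv ℝ f x‖ ≤ b := by
    have hcl : IsClosed {x | ‖fderiv ℝ f x‖ ≤ b} :=
      isClosed_le (hf.continuous_fderiv one_ne_zero).norm continuous_const
    have hint : interior s ⊆ {x | ‖fderiv ℝ f x‖ ≤ b} := fun x hx => by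
      refine norm_fderiv_le_of_lip' ℝ hb0 ?_
      filter_upwards [mem_interior_iff_mem_nhds.1 hx] with y hy
      exact hb y hy x (interior_subset hx)
    exact fun x hx => hcl.closure_subset_iff.2 hint (hs hx)
  refine add_le_add (iSup₂_le fun x hx => ?_) (iSup₂_le fun x hx => ?_)
  · rw [← ofReal_norm]
    exact ENNReal.ofReal_le_ofReal (ha x hx)
  · rw [← ofReal_norm, ((hf.differentiable one_ne_zero) x).fderivWithin (hu x hx)]
    exact ENNReal.ofReal_le_ofReal (hder x hx)

/-- A `C¹` function on `[0, L]` extends to a `C¹` function on `ℝ` supported in `[-1, L + 1]`. -/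
lemma exists_compactly_supported_extension {L : ℝ} (hL : 0 < L) {g : ℝ → ℝ}
    (hg : ContDiffOn ℝ 1 g (Icc 0 L)) :
    ∃ (f f' : ℝ → ℝ) (m : ℝ), 0 < m ∧ (∀ x, HasDerivAt f (f' x) x) ∧ Continuous f' ∧
      (∀ x ∈ Icc 0 L, f x = g x) ∧ (∀ x ≤ -1, f x = 0) ∧ (∀ x, L + 1 ≤ x → f x = 0) ∧
      (∀ x, |f x| ≤ m) ∧ ∀ x, |f' x| ≤ m := by
  -- The derivative is extended by its endpoint values and then integrated; a cutoff equal to 1 on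
  -- `[0, L]` gives compact support.
  set w : ℝ → ℝ := IccExtend hL.le ((Icc 0 L).domRestrict (derivWithin g (Icc 0 L))) with hw
  have hu : UniqueDiffOn ℝ (Icc 0 L) := uniqueDiffOn_Icc hL
  have hwc : Continuous w :=
    (continuousOn_iff_continuous_domRestrict.1
      (hg.continuousOn_derivWithin hu le_rfl)).Icc_extend'
  set F : ℝ → ℝ := fun x => g 0 + ∫ s in (0 : ℝ)..x, w s with hF
  have hFd : ∀ x, HasDerivAt F (w x) x := fun x =>
    (intervalIntegral.integral_hasDerivAt_right (hwc.intervalIntegrable _ _)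
      (hwc.stronglyMeasurableAtFilter _ _) hwc.continuousAt).const_add _
  have hFc : ContDiff ℝ 1 F := by
    rw [contDiff_one_iff_deriv]
    refine ⟨fun x => (hFd x).differentiableAt, ?_⟩
    rwa [show deriv F = w from funext fun x => (hFd x).deriv]
  have hFg : ∀ x ∈ Icc 0 L, F x = g x := by
    have h0 : ∀ x ∈ Icc 0 L, HasDerivWithinAt (fun x => F x - g x) 0 (Icc 0 L) x := by
      intro x hx
      have h1 := (hg.differentiableOn one_ne_zero x hx).hasDerivWithinAt
      have h2 := (hFd x).hasDerivWithinAt (s := Icc 0 L)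
      have hwx : w x = derivWithin g (Icc 0 L) x := by
        rw [hw, IccExtend_of_mem _ _ hx]; rfl
      rw [hwx] at h2
      simpa using h2.fun_sub h1
    intro x hx
    have := (convex_Icc 0 L).norm_image_sub_le_of_norm_hasDerivWithin_le (C := 0) h0
      (fun _ _ => by simp) (left_mem_Icc.2 hL.le) hx
    simp only [hF, intervalIntegral.integral_same, add_zero, sub_self, sub_zero, zero_mul,
      norm_le_zero_iff, sub_eq_zero] at this ⊢
    exact this
  let χ : ContDiffBump (L / 2) := ⟨L / 2, L / 2 + 1, by linarith, by linarith⟩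
  have hχ : ContDiff ℝ 1 χ := χ.contDiff
  have hfc : ContDiff ℝ 1 fun x => χ x * F x := hχ.mul hFc
  have hsupp : HasCompactSupport fun x => χ x * F x := χ.hasCompactSupport.mul_right
  obtain ⟨m₁, hm₁⟩ := hsupp.exists_bound_of_continuous hfc.continuous
  obtain ⟨m₂, hm₂⟩ := hsupp.deriv.exists_bound_of_continuous (hfc.continuous_deriv le_rfl)
  have hz : ∀ x, L / 2 + 1 ≤ |x - L / 2| → χ x * F x = 0 := fun x hx => by
    rw [χ.zero_of_le_dist (by simpa [Real.dist_eq] using hx), zero_mul]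
  -- The entry `1` in the maximum only ensures `0 < m`.
  refine ⟨fun x => χ x * F x, deriv fun x => χ x * F x, max 1 (max m₁ m₂), by positivity,
    fun x => (hfc.differentiable one_ne_zero x).hasDerivAt, hfc.continuous_deriv le_rfl,
    fun x hx => ?_, fun x hx => hz x ?_, fun x hx => hz x ?_, fun x => ?_, fun x => ?_⟩
  · beta_reduce
    rw [χ.one_of_mem_closedBall, one_mul, hFg x hx]
    rw [Metric.mem_closedBall, Real.dist_eq, abs_le]
    exact ⟨by change -(L / 2) ≤ _; linarith [hx.1], by change _ ≤ L / 2; linarith [hx.2]⟩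
  · rw [abs_of_nonpos (by linarith)]; linarith
  · rw [abs_of_nonneg (by linarith)]; linarith
  · exact (hm₁ x).trans ((le_max_left _ _).trans (le_max_right _ _))
  · exact (hm₂ x).trans ((le_max_right _ _).trans (le_max_right _ _))

/-! ### The filter with Dirichlet data: maximum principles uniform in `α`, and dependence on a
parameter. -/

/-- The solution `u` of `u - α² u'' = g`, `u 0 = g 0`, `u L = g L`, by variation of constants. -/
noncomputable def dirichletFilter (α L : ℝ) (g : ℝ → ℝ) (x : ℝ) : ℝ :=
  Real.cosh (α⁻¹ * x) * (g 0 + α⁻¹ * ∫ s in (0 : ℝ)..x, Real.sinh (α⁻¹ * s) * g s) +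
  Real.sinh (α⁻¹ * x) * ((g L - Real.cosh (α⁻¹ * L) * (g 0 + α⁻¹ *
    ∫ s in (0 : ℝ)..L, Real.sinh (α⁻¹ * s) * g s)) / Real.sinh (α⁻¹ * L) +
    α⁻¹ * (∫ s in (0 : ℝ)..L, Real.cosh (α⁻¹ * s) * g s) -
    α⁻¹ * ∫ s in (0 : ℝ)..x, Real.cosh (α⁻¹ * s) * g s)

/-- The derivative of `dirichletFilter α L g`. -/
noncomputable def dirichletFilterDeriv (α L : ℝ) (g : ℝ → ℝ) (x : ℝ) : ℝ :=
  α⁻¹ * (Real.sinh (α⁻¹ * x) * (g 0 + α⁻¹ * ∫ s in (0 : ℝ)..x, Real.sinh (α⁻¹ * s) * g s) +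
  Real.cosh (α⁻¹ * x) * ((g L - Real.cosh (α⁻¹ * L) * (g 0 + α⁻¹ *
    ∫ s in (0 : ℝ)..L, Real.sinh (α⁻¹ * s) * g s)) / Real.sinh (α⁻¹ * L) +
    α⁻¹ * (∫ s in (0 : ℝ)..L, Real.cosh (α⁻¹ * s) * g s) -
    α⁻¹ * ∫ s in (0 : ℝ)..x, Real.cosh (α⁻¹ * s) * g s))

section Filter

variable {α L : ℝ} {g : ℝ → ℝ}

lemma hasDerivAt_primitive {f : ℝ → ℝ} (hf : Continuous f) (x : ℝ) :
    HasDerivAt (fun x => ∫ s in (0 : ℝ)..x, f s) (f x) x :=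
  intervalIntegral.integral_hasDerivAt_right (hf.intervalIntegrable _ _)
    (hf.stronglyMeasurableAtFilter _ _) hf.continuousAt

lemma hasDerivAt_dirichletFilter (hg : Continuous g) (x : ℝ) :
    HasDerivAt (dirichletFilter α L g) (dirichletFilterDeriv α L g x) x := by
  have hk : HasDerivAt (fun x => α⁻¹ * x) α⁻¹ x := by simpa using (hasDerivAt_id x).const_mul α⁻¹
  have hS := hasDerivAt_primitive (f := fun s => Real.sinh (α⁻¹ * s) * g s) (by fun_prop) x
  have hC := hasDerivAt_primitive (f := fun s => Real.cosh (α⁻¹ * s) * g s) (by fun_prop) x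
  refine ((hk.cosh.fun_mul ((hS.const_mul α⁻¹).const_add (g 0))).fun_add
    (hk.sinh.fun_mul ((hC.const_mul α⁻¹).const_sub _))).congr_deriv ?_
  rw [dirichletFilterDeriv]
  ring

lemma hasDerivAt_dirichletFilterDeriv (hg : Continuous g) (x : ℝ) :
    HasDerivAt (dirichletFilterDeriv α L g) (α⁻¹ ^ 2 * (dirichletFilter α L g x - g x)) x := by
  have hk : HasDerivAt (fun x => α⁻¹ * x) α⁻¹ x := by simpa using (hasDerivAt_id x).const_mul α⁻¹
  have hS := hasDerivAt_primitive (f := fun s => Real.sinh (α⁻¹ * s) * g s) (by fun_prop) x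
  have hC := hasDerivAt_primitive (f := fun s => Real.cosh (α⁻¹ * s) * g s) (by fun_prop) x
  refine (((hk.sinh.fun_mul ((hS.const_mul α⁻¹).const_add (g 0))).fun_add
    (hk.cosh.fun_mul ((hC.const_mul α⁻¹).const_sub _))).const_mul α⁻¹).congr_deriv ?_
  rw [dirichletFilter]
  linear_combination (-α⁻¹ ^ 2 * g x) * Real.cosh_sq (α⁻¹ * x)

lemma dirichletFilter_zero : dirichletFilter α L g 0 = g 0 := by simp [dirichletFilter]

lemma dirichletFilter_right (hα : 0 < α) (hL : 0 < L) : dirichletFilter α L g L = g L := by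
  have : Real.sinh (α⁻¹ * L) ≠ 0 := (Real.sinh_pos_iff.2 (by positivity)).ne'
  rw [dirichletFilter]
  field_simp
  ring

lemma dirichletFilter_sub {g₁ g₂ : ℝ → ℝ} (h₁ : Continuous g₁) (h₂ : Continuous g₂) (x : ℝ) :
    dirichletFilter α L (fun s => g₁ s - g₂ s) x
      = dirichletFilter α L g₁ x - dirichletFilter α L g₂ x := by
  have hS : ∀ x, ∫ s in (0 : ℝ)..x, Real.sinh (α⁻¹ * s) * (g₁ s - g₂ s) =
      (∫ s in (0 : ℝ)..x, Real.sinh (α⁻¹ * s) * g₁ s) -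
      ∫ s in (0 : ℝ)..x, Real.sinh (α⁻¹ * s) * g₂ s := fun x => by
    rw [← intervalIntegral.integral_sub (Continuous.intervalIntegrable (by fun_prop) _ _)
      (Continuous.intervalIntegrable (by fun_prop) _ _)]
    simp only [mul_sub]
  have hC : ∀ x, ∫ s in (0 : ℝ)..x, Real.cosh (α⁻¹ * s) * (g₁ s - g₂ s) =
      (∫ s in (0 : ℝ)..x, Real.cosh (α⁻¹ * s) * g₁ s) -
      ∫ s in (0 : ℝ)..x, Real.cosh (α⁻¹ * s) * g₂ s := fun x => by
    rw [← intervalIntegral.integral_sub (Continuous.intervalIntegrable (by fun_prop) _ _)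
      (Continuous.intervalIntegrable (by fun_prop) _ _)]
    simp only [mul_sub]
  simp only [dirichletFilter, hS, hC]
  ring

lemma dirichletFilter_neg (g : ℝ → ℝ) (x : ℝ) :
    dirichletFilter α L (fun s => -g s) x = -dirichletFilter α L g x := by
  simp only [dirichletFilter, mul_neg, intervalIntegral.integral_neg]
  ring

/-- At an interior local maximum, up to a linear term, the filtered function is below the data. -/
lemma dirichletFilter_le_of_isLocalMax (hα : 0 < α) (hL : 0 < L) (hg : Continuous g) {M x : ℝ}
    (hx : x ∈ Icc 0 L)
    (hmax : x ∈ Ioo 0 L → IsLocalMax (fun s => dirichletFilter α L g s - M * s) x) :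
    dirichletFilter α L g x ≤ g x := by
  rcases eq_or_ne x 0 with rfl | h0
  · rw [dirichletFilter_zero]
  rcases eq_or_ne x L with rfl | h1
  · rw [dirichletFilter_right hα hL]
  have hm := hmax ⟨lt_of_le_of_ne hx.1 h0.symm, lt_of_le_of_ne hx.2 h1⟩
  set u : ℝ → ℝ := fun s => dirichletFilter α L g s - M * s with hu
  have hud : ∀ s, HasDerivAt u (dirichletFilterDeriv α L g s - M) s := fun s => by
    simpa using (hasDerivAt_dirichletFilter hg s).fun_sub ((hasDerivAt_id s).const_mul M)
  have hu1 : deriv u = fun s => dirichletFilterDeriv α L g s - M := funext fun s => (hud s).deriv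
  have hu2 : deriv (deriv u) x = α⁻¹ ^ 2 * (dirichletFilter α L g x - g x) := by
    rw [hu1]
    exact ((hasDerivAt_dirichletFilterDeriv hg x).sub_const M).deriv
  -- If the filtered function exceeded `g` at `x`, its second derivative would be positive, so `x`
  -- would be a local minimum as well as a local maximum. Then `u` is locally constant and its
  -- second derivative vanishes.
  by_contra! hlt
  have hpos : 0 < deriv (deriv u) x := by
    rw [hu2]
    exact mul_pos (by positivity) (by linarith)
  have hmin := isLocalMin_of_deriv_deriv_pos hpos hm.deriv_eq_zero (hud x).continuousAt
  have hconst : u =ᶠ[𝓝 x] fun _ => u x := by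
    filter_upwards [hm, hmin] with s h1 h2 using le_antisymm h1 h2
  have : deriv (deriv u) x = 0 := by
    rw [hconst.deriv.deriv_eq]
    simp
  linarith

lemma continuous_dirichletFilter (hg : Continuous g) : Continuous (dirichletFilter α L g) :=
  continuous_iff_continuousAt.2 fun x => (hasDerivAt_dirichletFilter hg x).continuousAt

lemma dirichletFilter_le (hα : 0 < α) (hL : 0 < L) (hg : Continuous g) {m : ℝ}
    (hm : ∀ x ∈ Icc 0 L, g x ≤ m) {x : ℝ} (hx : x ∈ Icc 0 L) : dirichletFilter α L g x ≤ m := by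
  obtain ⟨y, hy, hmax⟩ := isCompact_Icc.exists_isMaxOn (nonempty_Icc.2 hL.le)
    (continuous_dirichletFilter (α := α) (L := L) hg).continuousOn
  refine (hmax hx).trans ((dirichletFilter_le_of_isLocalMax hα hL hg (M := 0) hy
    fun hy' => ?_).trans (hm y hy))
  simpa using hmax.isLocalMax (Icc_mem_nhds hy'.1 hy'.2)

lemma abs_dirichletFilter_le (hα : 0 < α) (hL : 0 < L) (hg : Continuous g) {m : ℝ}
    (hm : ∀ x ∈ Icc 0 L, |g x| ≤ m) {x : ℝ} (hx : x ∈ Icc 0 L) :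
    |dirichletFilter α L g x| ≤ m := by
  refine abs_le'.2 ⟨dirichletFilter_le hα hL hg (fun y hy => (abs_le'.1 (hm y hy)).1) hx, ?_⟩
  rw [← dirichletFilter_neg]
  exact dirichletFilter_le hα hL hg.neg (fun y hy => (abs_le'.1 (hm y hy)).2) hx

lemma abs_dirichletFilter_sub_le (hα : 0 < α) (hL : 0 < L) {g₁ g₂ : ℝ → ℝ}
    (h₁ : Continuous g₁) (h₂ : Continuous g₂) {m : ℝ}
    (hm : ∀ x ∈ Icc 0 L, |g₁ x - g₂ x| ≤ m) {x : ℝ} (hx : x ∈ Icc 0 L) :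
    |dirichletFilter α L g₁ x - dirichletFilter α L g₂ x| ≤ m := by
  rw [← dirichletFilter_sub h₁ h₂]
  exact abs_dirichletFilter_le hα hL (h₁.sub h₂) hm hx

/-- The maximum principle applied to the difference: on `[0, L]` the filter sees only the values of
its data on `[0, L]`. -/
lemma dirichletFilter_congr (hα : 0 < α) (hL : 0 < L) {g₁ g₂ : ℝ → ℝ}
    (h₁ : Continuous g₁) (h₂ : Continuous g₂) (h : ∀ x ∈ Icc 0 L, g₁ x = g₂ x) {x : ℝ}
    (hx : x ∈ Icc 0 L) : dirichletFilter α L g₁ x = dirichletFilter α L g₂ x := by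
  have := abs_dirichletFilter_sub_le hα hL h₁ h₂ (m := 0) (fun y hy => by simp [h y hy]) hx
  exact sub_eq_zero.1 (abs_nonpos_iff.1 this)

lemma exists_maximal_increment {w : ℝ → ℝ} (hw : Continuous w) (hL : 0 ≤ L) :
    ∃ a ∈ Icc 0 L, ∃ b ∈ Icc 0 L, b ≤ a ∧
      ∀ c ∈ Icc 0 L, ∀ d ∈ Icc 0 L, d ≤ c → w c - w d ≤ w a - w b := by
  have hK : IsCompact ((Icc 0 L ×ˢ Icc 0 L) ∩ {q : ℝ × ℝ | q.2 ≤ q.1}) :=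
    (isCompact_Icc.prod isCompact_Icc).inter_right (isClosed_le continuous_snd continuous_fst)
  have h0 : (0 : ℝ) ∈ Icc 0 L := left_mem_Icc.2 hL
  obtain ⟨⟨a, b⟩, ⟨⟨ha, hb⟩, hba⟩, hmax⟩ := hK.exists_isMaxOn ⟨(0, 0), ⟨h0, h0⟩, le_refl (0 : ℝ)⟩
    (f := fun q : ℝ × ℝ => w q.1 - w q.2) (Continuous.continuousOn (by fun_prop))
  exact ⟨a, ha, b, hb, hba, fun c hc d hd hdc => isMaxOn_iff.1 hmax (c, d) ⟨⟨hc, hd⟩, hdc⟩⟩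

/-- A two-point maximum principle. Let `b ≤ a` maximise the increment of `u s - M * s`, where `u` is
the filter of `g`. If `b < a`, then `a` is an endpoint or a local maximum and `b` an endpoint or a
local minimum, so `u a ≤ g a` and `g b ≤ u b`. Hence `u a - u b ≤ g a - g b ≤ M * (a - b)`, and the
maximal increment is nonpositive. -/
lemma dirichletFilter_sub_le (hα : 0 < α) (hL : 0 < L) (hg : Continuous g) {M : ℝ}
    (hM : ∀ x ∈ Icc 0 L, ∀ y ∈ Icc 0 L, |g x - g y| ≤ M * |x - y|) {x y : ℝ}
    (hx : x ∈ Icc 0 L) (hy : y ∈ Icc 0 L) (hyx : y ≤ x) :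
    dirichletFilter α L g x - dirichletFilter α L g y ≤ M * (x - y) := by
  have huc : Continuous fun s => dirichletFilter α L g s - M * s :=
    (continuous_dirichletFilter hg).sub (continuous_const.mul continuous_id)
  obtain ⟨a, ha, b, hb, hba, hmax⟩ := exists_maximal_increment huc hL.le
  have hxy := hmax x hx y hy hyx
  suffices (dirichletFilter α L g a - M * a) - (dirichletFilter α L g b - M * b) ≤ 0 by linarith
  rcases hba.eq_or_lt with rfl | hlt
  · simp
  have h1 : dirichletFilter α L g a ≤ g a := dirichletFilter_le_of_isLocalMax hα hL hg (M := M) ha fun ha' => by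
    filter_upwards [Icc_mem_nhds ha'.1 ha'.2, Ioi_mem_nhds hlt] with s hs hs'
    have := hmax s hs b hb (le_of_lt hs')
    linarith
  have hng : Continuous fun s => -g s := hg.neg
  have h2 : dirichletFilter α L (fun s => -g s) b ≤ -g b := by
    refine dirichletFilter_le_of_isLocalMax hα hL hng (M := -M) hb fun hb' => ?_
    filter_upwards [Icc_mem_nhds hb'.1 hb'.2, Iio_mem_nhds hlt] with s hs hs'
    have := hmax a ha s hs (le_of_lt hs')
    rw [dirichletFilter_neg, dirichletFilter_neg]
    linarith
  rw [dirichletFilter_neg] at h2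
  have h3 := (abs_le.1 (hM a ha b hb)).2
  rw [abs_of_pos (sub_pos.2 hlt)] at h3
  linarith

lemma abs_dirichletFilter_apply_sub_le (hα : 0 < α) (hL : 0 < L) (hg : Continuous g) {M : ℝ}
    (hM : ∀ x ∈ Icc 0 L, ∀ y ∈ Icc 0 L, |g x - g y| ≤ M * |x - y|) {x y : ℝ}
    (hx : x ∈ Icc 0 L) (hy : y ∈ Icc 0 L) :
    |dirichletFilter α L g x - dirichletFilter α L g y| ≤ M * |x - y| := by
  wlog hyx : y ≤ x generalizing x y
  · rw [abs_sub_comm, abs_sub_comm x]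
    exact this hy hx (le_of_not_ge hyx)
  rw [abs_of_nonneg (sub_nonneg.2 hyx)]
  refine abs_le'.2 ⟨dirichletFilter_sub_le hα hL hg hM hx hy hyx, ?_⟩
  have hng : Continuous fun s => -g s := hg.neg
  have := dirichletFilter_sub_le hα hL hng (M := M) (fun x hx y hy => by
    rw [neg_sub_neg, abs_sub_comm]; exact hM x hx y hy) hx hy hyx
  rw [dirichletFilter_neg, dirichletFilter_neg] at this
  linarith

lemma abs_dirichletFilterDeriv_le (hα : 0 < α) (hL : 0 < L) (hg : Continuous g) {M : ℝ}
    (hM : ∀ x ∈ Icc 0 L, ∀ y ∈ Icc 0 L, |g x - g y| ≤ M * |x - y|) {x : ℝ}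
    (hx : x ∈ Icc 0 L) : |dirichletFilterDeriv α L g x| ≤ M :=
  abs_deriv_le_of_abs_sub_le hL (hasDerivAt_dirichletFilter hg)
    (continuous_iff_continuousAt.2 fun x => (hasDerivAt_dirichletFilterDeriv hg x).continuousAt)
    (fun _ hx _ hy => abs_dirichletFilter_apply_sub_le hα hL hg hM hx hy) hx

variable {Y Y₁ : ℝ → ℝ → ℝ}

lemma continuous_dirichletFilter_param (hY : Continuous fun q : ℝ × ℝ => Y q.1 q.2) :
    Continuous fun q : ℝ × ℝ => dirichletFilter α L (Y q.1) q.2 := by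
  have h : ∀ c : ℝ, Continuous fun q : ℝ × ℝ => Y q.1 c := fun c =>
    hY.comp (continuous_fst.prodMk continuous_const)
  have hS : Continuous (Function.uncurry fun (q : ℝ × ℝ) s => Real.sinh (α⁻¹ * s) * Y q.1 s) :=
    (Real.continuous_sinh.comp (continuous_const.mul continuous_snd)).mul
      (hY.comp ((continuous_fst.comp continuous_fst).prodMk continuous_snd))
  have hC : Continuous (Function.uncurry fun (q : ℝ × ℝ) s => Real.cosh (α⁻¹ * s) * Y q.1 s) :=
    (Real.continuous_cosh.comp (continuous_const.mul continuous_snd)).mul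
      (hY.comp ((continuous_fst.comp continuous_fst).prodMk continuous_snd))
  have h1 := h 0
  have h2 := h L
  unfold dirichletFilter
  fun_prop

lemma continuous_dirichletFilterDeriv_param (hY : Continuous fun q : ℝ × ℝ => Y q.1 q.2) :
    Continuous fun q : ℝ × ℝ => dirichletFilterDeriv α L (Y q.1) q.2 := by
  have h : ∀ c : ℝ, Continuous fun q : ℝ × ℝ => Y q.1 c := fun c =>
    hY.comp (continuous_fst.prodMk continuous_const)
  have hS : Continuous (Function.uncurry fun (q : ℝ × ℝ) s => Real.sinh (α⁻¹ * s) * Y q.1 s) :=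
    (Real.continuous_sinh.comp (continuous_const.mul continuous_snd)).mul
      (hY.comp ((continuous_fst.comp continuous_fst).prodMk continuous_snd))
  have hC : Continuous (Function.uncurry fun (q : ℝ × ℝ) s => Real.cosh (α⁻¹ * s) * Y q.1 s) :=
    (Real.continuous_cosh.comp (continuous_const.mul continuous_snd)).mul
      (hY.comp ((continuous_fst.comp continuous_fst).prodMk continuous_snd))
  have h1 := h 0
  have h2 := h L
  unfold dirichletFilterDeriv
  fun_prop

lemma hasDerivAt_integral_param (hd : ∀ t x, HasDerivAt (fun s => Y s x) (Y₁ t x) t)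
    (hY : Continuous fun q : ℝ × ℝ => Y q.1 q.2) (hY₁ : Continuous fun q : ℝ × ℝ => Y₁ q.1 q.2)
    {a : ℝ → ℝ} (ha : Continuous a) (x t : ℝ) :
    HasDerivAt (fun t => ∫ s in (0 : ℝ)..x, a s * Y t s) (∫ s in (0 : ℝ)..x, a s * Y₁ t s) t := by
  have hc : ∀ t, Continuous fun s => a s * Y t s := fun t =>
    ha.mul (hY.comp (continuous_const.prodMk continuous_id))
  have hc₁ : ∀ t, Continuous fun s => a s * Y₁ t s := fun t =>
    ha.mul (hY₁.comp (continuous_const.prodMk continuous_id))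
  have hcu : Continuous fun q : ℝ × ℝ => a q.2 * Y₁ q.1 q.2 := (ha.comp continuous_snd).mul hY₁
  obtain ⟨C, hC⟩ := ((isCompact_closedBall t 1).prod (isCompact_uIcc (a := (0 : ℝ)) (b := x)))
    |>.exists_bound_of_continuousOn hcu.continuousOn
  refine (intervalIntegral.hasDerivAt_integral_of_dominated_loc_of_deriv_le
    (F := fun t s => a s * Y t s) (F' := fun t s => a s * Y₁ t s) (bound := fun _ => C)
    (Metric.closedBall_mem_nhds t one_pos)
    (Eventually.of_forall fun t => (hc t).aestronglyMeasurable)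
    ((hc t).intervalIntegrable _ _) (hc₁ t).aestronglyMeasurable
    (Eventually.of_forall fun s hs t' ht' => hC (t', s) ⟨ht', uIoc_subset_uIcc hs⟩)
    intervalIntegrable_const
    (Eventually.of_forall fun s _ t' _ => (hd t' s).const_mul (a s))).2

/-- The filter is linear in its data through point values and integrals, so it commutes with the
time derivative. -/
lemma hasDerivAt_dirichletFilter_param (hd : ∀ t x, HasDerivAt (fun s => Y s x) (Y₁ t x) t)
    (hY : Continuous fun q : ℝ × ℝ => Y q.1 q.2) (hY₁ : Continuous fun q : ℝ × ℝ => Y₁ q.1 q.2)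
    (t x : ℝ) :
    HasDerivAt (fun s => dirichletFilter α L (Y s) x) (dirichletFilter α L (Y₁ t) x) t := by
  have hS := hasDerivAt_integral_param hd hY hY₁ (a := fun s => Real.sinh (α⁻¹ * s))
    (by fun_prop)
  have hC := hasDerivAt_integral_param hd hY hY₁ (a := fun s => Real.cosh (α⁻¹ * s))
    (by fun_prop)
  exact (((hd t 0).fun_add ((hS x t).const_mul α⁻¹)).const_mul _).fun_add
    ((((((hd t L).fun_sub (((hd t 0).fun_add ((hS L t).const_mul α⁻¹)).const_mul _)).div_const
      _).fun_add ((hC L t).const_mul α⁻¹)).fun_sub ((hC x t).const_mul α⁻¹)).const_mul _)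

lemma contDiff_dirichletFilter_param (hd : ∀ t x, HasDerivAt (fun s => Y s x) (Y₁ t x) t)
    (hY : Continuous fun q : ℝ × ℝ => Y q.1 q.2)
    (hY₁ : Continuous fun q : ℝ × ℝ => Y₁ q.1 q.2) :
    ContDiff ℝ 1 fun q : ℝ × ℝ => dirichletFilter α L (Y q.1) q.2 :=
  contDiff_one_of_partial_derivs (f := fun t => dirichletFilter α L (Y t))
    (hasDerivAt_dirichletFilter_param hd hY hY₁)
    (fun _ x => hasDerivAt_dirichletFilter (hY.comp (continuous_const.prodMk continuous_id)) x)
    (continuous_dirichletFilter_param hY₁) (continuous_dirichletFilterDeriv_param hY)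

lemma contDiff_two_dirichletFilter (hg : Continuous g) :
    ContDiff ℝ 2 (dirichletFilter α L g) := by
  have h1 : deriv (dirichletFilter α L g) = dirichletFilterDeriv α L g :=
    funext fun x => (hasDerivAt_dirichletFilter hg x).deriv
  have h2 : deriv (dirichletFilterDeriv α L g) =
      fun x => α⁻¹ ^ 2 * (dirichletFilter α L g x - g x) :=
    funext fun x => (hasDerivAt_dirichletFilterDeriv hg x).deriv
  rw [show (2 : WithTop ℕ∞) = 1 + 1 by norm_num, contDiff_succ_iff_deriv, h1,
    contDiff_one_iff_deriv, h2]
  refine ⟨fun x => (hasDerivAt_dirichletFilter hg x).differentiableAt, by simp,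
    fun x => (hasDerivAt_dirichletFilterDeriv hg x).differentiableAt, ?_⟩
  have := continuous_dirichletFilter (α := α) (L := L) hg
  fun_prop

end Filter

/-! ### Extension of the filtered velocity from `[0, L]` to the line. -/

/-- Projection onto `[0, L]`. -/
noncomputable def clampTo (L x : ℝ) : ℝ := max 0 (min x L)

/-- A point of `[0, L]` attached to `x`: the point itself inside `[0, L]`, and a compressed
reflection of `x` across the nearest endpoint outside `[0, L]`. -/
noncomputable def foldTo (L x : ℝ) : ℝ :=
  clampTo L x - L * (x - clampTo L x) / max (max L x) (L - x)

/-- A bounded extension from `[0, L]` to `ℝ` which preserves `C¹` regularity. -/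
noncomputable def reflectExt (L : ℝ) (f : ℝ → ℝ) (x : ℝ) : ℝ :=
  2 * f (clampTo L x) - f (foldTo L x)

section Extension

variable {L : ℝ} {x : ℝ}

lemma clampTo_mem (hL : 0 < L) (x : ℝ) : clampTo L x ∈ Icc 0 L :=
  ⟨le_max_left _ _, max_le hL.le (min_le_right _ _)⟩

lemma clampTo_of_mem (hx : x ∈ Icc 0 L) : clampTo L x = x := by
  rw [clampTo, min_eq_left hx.2, max_eq_right hx.1]

lemma clampTo_of_nonpos (hx : x ≤ 0) : clampTo L x = 0 :=
  max_eq_left ((min_le_left _ _).trans hx)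

lemma clampTo_of_le (hL : 0 < L) (hx : L ≤ x) : clampTo L x = L := by
  rw [clampTo, min_eq_right hx, max_eq_right hL.le]

@[fun_prop]
lemma continuous_clampTo (L : ℝ) : Continuous (clampTo L) :=
  continuous_const.max (continuous_id.min continuous_const)

lemma foldTo_of_mem (hx : x ∈ Icc 0 L) : foldTo L x = x := by
  simp [foldTo, clampTo_of_mem hx]

lemma scale_of_nonpos (hL : 0 < L) (hx : x ≤ 0) : max (max L x) (L - x) = L - x :=
  max_eq_right (max_le (by linarith) (by linarith))

lemma scale_of_le (hL : 0 < L) (hx : L ≤ x) : max (max L x) (L - x) = x := by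
  rw [max_eq_right hx, max_eq_left (by linarith)]

lemma scale_of_mem (hx : x ∈ Icc 0 L) : max (max L x) (L - x) = L := by
  rw [max_eq_left hx.2, max_eq_left (by linarith [hx.1])]

lemma scale_pos (hL : 0 < L) (x : ℝ) : 0 < max (max L x) (L - x) :=
  hL.trans_le ((le_max_left _ _).trans (le_max_left _ _))

lemma foldTo_of_nonpos (hL : 0 < L) (hx : x ≤ 0) : foldTo L x = L - L ^ 2 / (L - x) := by
  have : L - x ≠ 0 := by linarith
  rw [foldTo, clampTo_of_nonpos hx, scale_of_nonpos hL hx]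
  field_simp
  ring

lemma foldTo_of_le (hL : 0 < L) (hx : L ≤ x) : foldTo L x = L ^ 2 / x := by
  have : x ≠ 0 := by linarith
  rw [foldTo, clampTo_of_le hL hx, scale_of_le hL hx]
  field_simp
  ring

lemma foldTo_mem (hL : 0 < L) (x : ℝ) : foldTo L x ∈ Icc 0 L := by
  have key : ∀ y, L ≤ y → L ^ 2 / y ∈ Icc 0 L := fun y hy => by
    have hy0 : 0 < y := hL.trans_le hy
    refine ⟨by positivity, ?_⟩
    rw [div_le_iff₀ hy0]
    nlinarith
  rcases le_total x 0 with h0 | h0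
  · rw [foldTo_of_nonpos hL h0]
    have := key (L - x) (by linarith)
    exact ⟨by linarith [this.2], by linarith [this.1]⟩
  · rcases le_total x L with h1 | h1
    · rw [foldTo_of_mem ⟨h0, h1⟩]
      exact ⟨h0, h1⟩
    · rw [foldTo_of_le hL h1]
      exact key x h1

lemma continuous_foldTo (hL : 0 < L) : Continuous (foldTo L) := by
  unfold foldTo
  refine (continuous_clampTo L).sub (Continuous.div (by fun_prop) (by fun_prop) fun x => ?_)
  exact (scale_pos hL x).ne'

lemma reflectExt_of_mem {f : ℝ → ℝ} (hx : x ∈ Icc 0 L) : reflectExt L f x = f x := by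
  rw [reflectExt, clampTo_of_mem hx, foldTo_of_mem hx]
  ring

lemma abs_reflectExt_le (hL : 0 < L) {f : ℝ → ℝ} {m : ℝ} (hf : ∀ x ∈ Icc 0 L, |f x| ≤ m) (x : ℝ) :
    |reflectExt L f x| ≤ 3 * m := by
  have h1 := abs_le.1 (hf _ (clampTo_mem hL x))
  have h2 := abs_le.1 (hf _ (foldTo_mem hL x))
  rw [reflectExt, abs_le]
  constructor <;> linarith

lemma abs_reflectExt_sub_le (hL : 0 < L) {f g : ℝ → ℝ} {m : ℝ}
    (hf : ∀ x ∈ Icc 0 L, |f x - g x| ≤ m) (x : ℝ) :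
    |reflectExt L f x - reflectExt L g x| ≤ 3 * m := by
  have h1 := abs_le.1 (hf _ (clampTo_mem hL x))
  have h2 := abs_le.1 (hf _ (foldTo_mem hL x))
  rw [reflectExt, reflectExt, abs_le]
  constructor <;> linarith

/-- An odd reflection about the endpoint value keeps the slope. The compression has slope of modulus
1 at the endpoint, so the one-sided derivatives at `0` and `L` agree, and it keeps all arguments of
`f` inside `[0, L]`. -/
lemma hasDerivAt_reflectExt (hL : 0 < L) {f f' : ℝ → ℝ} (hf : ∀ x, HasDerivAt f (f' x) x) (x : ℝ) :
    HasDerivAt (reflectExt L f) (f' (foldTo L x) * (L / max (max L x) (L - x)) ^ 2) x := by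
  set w : ℝ → ℝ := fun x => f' (foldTo L x) * (L / max (max L x) (L - x)) ^ 2 with hw
  have hleft : ∀ x ≤ 0, HasDerivWithinAt (reflectExt L f) (w x) (Iic 0) x := fun x hx => by
    have hne : L - x ≠ 0 := by linarith
    have h1 : HasDerivAt (fun x => L - L ^ 2 / (L - x)) (-(L / (L - x)) ^ 2) x := by
      refine (((hasDerivAt_id' x).const_sub L).fun_inv hne |>.const_mul (L ^ 2)
        |>.const_sub L).congr_deriv ?_
      field_simp
    have h2 : HasDerivAt (fun x => 2 * f 0 - f (L - L ^ 2 / (L - x))) (w x) x := by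
      refine (((hf (L - L ^ 2 / (L - x))).comp x h1).const_sub (2 * f 0)).congr_deriv ?_
      rw [hw]
      beta_reduce
      rw [foldTo_of_nonpos hL hx, scale_of_nonpos hL hx]
      ring
    refine h2.hasDerivWithinAt.congr_of_mem (fun y hy => ?_) hx
    rw [reflectExt, clampTo_of_nonpos hy, foldTo_of_nonpos hL hy]
  have hmid : ∀ x ∈ Icc 0 L, HasDerivWithinAt (reflectExt L f) (w x) (Icc 0 L) x := fun x hx => by
    refine ((hf x).hasDerivWithinAt.congr_of_mem (fun y hy => reflectExt_of_mem hy)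
      hx).congr_deriv ?_
    simp [hw, foldTo_of_mem hx, scale_of_mem hx, hL.ne']
  have hright : ∀ x, L ≤ x → HasDerivWithinAt (reflectExt L f) (w x) (Ici L) x := fun x hx => by
    have hne : x ≠ 0 := by linarith
    have h1 : HasDerivAt (fun x => L ^ 2 / x) (-(L / x) ^ 2) x := by
      refine ((hasDerivAt_inv hne).const_mul (L ^ 2)).congr_deriv ?_
      field_simp
    have h2 : HasDerivAt (fun x => 2 * f L - f (L ^ 2 / x)) (w x) x := by
      refine (((hf (L ^ 2 / x)).comp x h1).const_sub (2 * f L)).congr_deriv ?_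
      rw [hw]
      beta_reduce
      rw [foldTo_of_le hL hx, scale_of_le hL hx]
      ring
    refine h2.hasDerivWithinAt.congr_of_mem (fun y hy => ?_) hx
    rw [reflectExt, clampTo_of_le hL hy, foldTo_of_le hL hy]
  rcases lt_trichotomy x 0 with h0 | rfl | h0
  · exact (hleft x h0.le).hasDerivAt (Iic_mem_nhds h0)
  · have h := (hleft 0 le_rfl).union (hmid 0 (left_mem_Icc.2 hL.le))
    rw [Iic_union_Icc_eq_Iic hL.le] at h
    exact h.hasDerivAt (Iic_mem_nhds hL)
  rcases lt_trichotomy x L with h1 | rfl | h1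
  · exact (hmid x ⟨h0.le, h1.le⟩).hasDerivAt (Icc_mem_nhds h0 h1)
  · have h := (hmid x (right_mem_Icc.2 hL.le)).union (hright x le_rfl)
    rw [Icc_union_Ici_eq_Ici hL.le] at h
    exact h.hasDerivAt (Ici_mem_nhds hL)
  · exact (hright x h1.le).hasDerivAt (Ici_mem_nhds h1)

lemma abs_reflectExt_deriv_le (hL : 0 < L) {f' : ℝ → ℝ} {M : ℝ} (hf : ∀ x ∈ Icc 0 L, |f' x| ≤ M)
    (x : ℝ) : |f' (foldTo L x) * (L / max (max L x) (L - x)) ^ 2| ≤ M := by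
  have h1 := hf _ (foldTo_mem hL x)
  have h2 : L / max (max L x) (L - x) ≤ 1 :=
    (div_le_one (scale_pos hL x)).2 ((le_max_left _ _).trans (le_max_left _ _))
  have h3 : 0 ≤ L / max (max L x) (L - x) := div_nonneg hL.le (scale_pos hL x).le
  rw [abs_mul, abs_of_nonneg (by positivity : 0 ≤ (L / max (max L x) (L - x)) ^ 2)]
  exact (mul_le_of_le_one_right (abs_nonneg _) (pow_le_one₀ h3 h2)).trans h1

end Extension

/-! ### Global flows of bounded regular fields and their derivatives. -/

/-- A bounded time-dependent vector field on `ℝ` with bounded continuous space derivative. -/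
structure IsRegularField (v v' : ℝ → ℝ → ℝ) (V K : ℝ) : Prop where
  continuous : Continuous fun q : ℝ × ℝ => v q.1 q.2
  continuous_deriv : Continuous fun q : ℝ × ℝ => v' q.1 q.2
  hasDerivAt : ∀ t x, HasDerivAt (v t) (v' t x) x
  abs_le : ∀ t x, |v t x| ≤ V
  abs_deriv_le : ∀ t x, |v' t x| ≤ K

/-- `φ t x s` is the position at time `s` of the integral curve of `v` through `x` at time `t`. -/
structure IsFlow (v : ℝ → ℝ → ℝ) (φ : ℝ → ℝ → ℝ → ℝ) : Prop where
  self : ∀ t x, φ t x t = x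
  hasDerivAt : ∀ t x s, HasDerivAt (φ t x) (v s (φ t x s)) s

/-- Carathéodory's criterion for differentiability. -/
lemma hasDerivAt_of_sub_eq_mul {f G : ℝ → ℝ} {x : ℝ} (hG : ContinuousAt G x)
    (h : ∀ y, f y - f x = (y - x) * G y) : HasDerivAt f (G x) x := by
  rw [hasDerivAt_iff_tendsto_slope]
  refine (hG.tendsto.mono_left nhdsWithin_le_nhds).congr' ?_
  filter_upwards [self_mem_nhdsWithin] with y hy
  rw [slope_def_field, h y, mul_div_cancel_left₀ _ (sub_ne_zero.2 hy)]

namespace IsRegularField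

variable {v v' : ℝ → ℝ → ℝ} {V K : ℝ}

lemma abs_sub_le (hv : IsRegularField v v' V K) (t x y : ℝ) : |v t x - v t y| ≤ K * |x - y| :=
  abs_sub_le_of_hasDerivAt_of_abs_le convex_univ (fun x _ => hv.hasDerivAt t x)
    (fun x _ => hv.abs_deriv_le t x) (mem_univ x) (mem_univ y)

lemma bound_nonneg (hv : IsRegularField v v' V K) : 0 ≤ V := (abs_nonneg _).trans (hv.abs_le 0 0)

lemma deriv_bound_nonneg (hv : IsRegularField v v' V K) : 0 ≤ K :=
  (abs_nonneg _).trans (hv.abs_deriv_le 0 0)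

lemma lipschitzWith (hv : IsRegularField v v' V K) (t : ℝ) :
    LipschitzWith ⟨K, hv.deriv_bound_nonneg⟩ (v t) :=
  LipschitzWith.of_dist_le_mul fun x y => by
    rw [Real.dist_eq, Real.dist_eq]
    exact hv.abs_sub_le t x y

lemma exists_curve_on (hv : IsRegularField v v' V K) (t x : ℝ) {R : ℝ} (hR : 0 ≤ R) :
    ∃ γ : ℝ → ℝ, γ t = x ∧ ∀ s ∈ Ioo (t - R) (t + R), HasDerivAt γ (v s (γ s)) s := by
  have hmem : t ∈ Icc (t - R) (t + R) := ⟨by linarith, by linarith⟩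
  -- With speed at most `V`, a curve stays within `V * R` of `x` during time `R`; as the bounds are
  -- global, any window length is allowed.
  have hpl : IsPicardLindelof v (⟨t, hmem⟩ : Icc (t - R) (t + R)) x
      (⟨V, hv.bound_nonneg⟩ * ⟨R, hR⟩) 0 ⟨V, hv.bound_nonneg⟩ ⟨K, hv.deriv_bound_nonneg⟩ :=
    { lipschitzOnWith := fun s _ => (hv.lipschitzWith s).lipschitzOnWith
      continuousOn := fun y _ =>
        (hv.continuous.comp (continuous_id.prodMk continuous_const)).continuousOn
      norm_le := fun s _ y _ => hv.abs_le s y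
      mul_max_le := by simp; rfl }
  obtain ⟨γ, h0, hγ⟩ := hpl.exists_eq_forall_mem_Icc_hasDerivWithinAt₀
  exact ⟨γ, h0, fun s hs => (hγ s (Ioo_subset_Icc_self hs)).hasDerivAt (Icc_mem_nhds hs.1 hs.2)⟩

/-- Solutions on the windows of radius `n + 1` agree by uniqueness and are glued; at time `s` the
index `⌈|s - t|⌉₊` gives a window containing `s` in its interior. -/
lemma exists_curve (hv : IsRegularField v v' V K) (t x : ℝ) :
    ∃ γ : ℝ → ℝ, γ t = x ∧ ∀ s, HasDerivAt γ (v s (γ s)) s := by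
  choose c hc0 hc using fun n : ℕ => hv.exists_curve_on t x (R := n + 1) (by positivity)
  have huniq : ∀ n m : ℕ, n ≤ m →
      EqOn (c n) (c m) (Ioo (t - ((n : ℝ) + 1)) (t + ((n : ℝ) + 1))) := fun n m hnm => by
    have hnm' : (n : ℝ) ≤ m := Nat.cast_le.2 hnm
    have hn : (0 : ℝ) ≤ n := n.cast_nonneg
    refine ODE_solution_unique_of_mem_Ioo (v := v) (s := fun _ => univ) (t₀ := t)
      (fun s _ => (hv.lipschitzWith s).lipschitzOnWith) ⟨by linarith, by linarith⟩
      (fun s hs => ⟨hc n s hs, mem_univ _⟩)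
      (fun s hs => ⟨hc m s ⟨by linarith [hs.1], by linarith [hs.2]⟩, mem_univ _⟩)
      (by rw [hc0, hc0])
  refine ⟨fun s => c ⌈|s - t|⌉₊ s, by simp [hc0], fun s => ?_⟩
  set N : ℕ := ⌈|s - t|⌉₊ + 1 with hN
  have hsN : |s - t| < N := by
    have := Nat.le_ceil |s - t|
    rw [hN]
    push_cast
    linarith
  have hloc : ∀ r, |r - t| < N → c ⌈|r - t|⌉₊ r = c N r := fun r hr => by
    refine huniq _ _ (Nat.ceil_le.2 hr.le) ?_
    have := Nat.le_ceil |r - t|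
    have := abs_lt.1 (lt_of_le_of_lt this (lt_add_one _))
    exact ⟨by linarith, by linarith⟩
  have hev : (fun r => c ⌈|r - t|⌉₊ r) =ᶠ[𝓝 s] c N := by
    have : ∀ᶠ r in 𝓝 s, |r - t| < N :=
      (continuous_id.sub continuous_const).abs.continuousAt.eventually_lt continuousAt_const hsN
    filter_upwards [this] with r hr using hloc r hr
  beta_reduce
  rw [hloc s hsN]
  have := abs_lt.1 hsN
  exact (hc N s ⟨by linarith, by linarith⟩).congr_of_eventuallyEq hev

lemma exists_isFlow (hv : IsRegularField v v' V K) : ∃ φ, IsFlow v φ := by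
  choose φ h0 h1 using hv.exists_curve
  exact ⟨φ, h0, h1⟩

variable {φ : ℝ → ℝ → ℝ → ℝ}

lemma abs_curve_sub_le (hv : IsRegularField v v' V K) {γ₁ γ₂ : ℝ → ℝ}
    (h₁ : ∀ s, HasDerivAt γ₁ (v s (γ₁ s)) s) (h₂ : ∀ s, HasDerivAt γ₂ (v s (γ₂ s)) s) (t s : ℝ) :
    |γ₁ s - γ₂ s| ≤ |γ₁ t - γ₂ t| * Real.exp (|s - t| * K) :=
  abs_le_mul_exp_of_hasDerivAt (h := fun s => γ₁ s - γ₂ s) (fun s => (h₁ s).fun_sub (h₂ s))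
    fun s _ => hv.abs_sub_le s _ _

lemma abs_flow_sub_le (hv : IsRegularField v v' V K) (hφ : IsFlow v φ) (t x y s : ℝ) :
    |φ t x s - φ t y s| ≤ |x - y| * Real.exp (|s - t| * K) := by
  simpa [hφ.self] using hv.abs_curve_sub_le (hφ.hasDerivAt t x) (hφ.hasDerivAt t y) t s

lemma flow_trans (hv : IsRegularField v v' V K) (hφ : IsFlow v φ) (t x r s : ℝ) :
    φ r (φ t x r) s = φ t x s := by
  have := hv.abs_curve_sub_le (hφ.hasDerivAt r (φ t x r)) (hφ.hasDerivAt t x) r s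
  rw [hφ.self, sub_self, abs_zero, zero_mul] at this
  exact sub_eq_zero.1 (abs_nonpos_iff.1 this)

lemma abs_flow_time_sub_le (hv : IsRegularField v v' V K) (hφ : IsFlow v φ) (t x r s : ℝ) :
    |φ t x r - φ t x s| ≤ V * |r - s| :=
  abs_sub_le_of_hasDerivAt_of_abs_le convex_univ (fun s _ => hφ.hasDerivAt t x s)
    (fun s _ => hv.abs_le s _) (mem_univ r) (mem_univ s)

/-- Joint continuity follows from Lipschitz bounds in the arrival time, the starting point and,
after restarting at time `t` by `flow_trans`, the starting time. -/
lemma continuous_flow (hv : IsRegularField v v' V K) (hφ : IsFlow v φ) :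
    Continuous fun q : ℝ × ℝ × ℝ => φ q.1 q.2.1 q.2.2 := by
  rw [continuous_iff_continuousAt]
  rintro ⟨t, x, s⟩
  have hlim : Tendsto (fun q : ℝ × ℝ × ℝ => V * |q.2.2 - s| +
      (|q.2.1 - x| + V * |t - q.1|) * Real.exp (|s - t| * K)) (𝓝 (t, x, s)) (𝓝 0) := by
    have : Continuous fun q : ℝ × ℝ × ℝ => V * |q.2.2 - s| +
      (|q.2.1 - x| + V * |t - q.1|) * Real.exp (|s - t| * K) := by fun_prop
    simpa using this.tendsto (t, x, s)
  refine tendsto_iff_dist_tendsto_zero.2 (squeeze_zero (fun _ => dist_nonneg) (fun q => ?_) hlim)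
  obtain ⟨t', x', s'⟩ := q
  have h1 := hv.abs_flow_time_sub_le hφ t' x' s' s
  have h2 := hv.abs_flow_sub_le hφ t (φ t' x' t) x s
  rw [hv.flow_trans hφ] at h2
  have h3 := hv.abs_flow_time_sub_le hφ t' x' t t'
  rw [hφ.self] at h3
  have h4 : |φ t' x' t - x| ≤ |x' - x| + V * |t - t'| := by
    linarith [_root_.abs_sub_le (φ t' x' t) x' x]
  have h5 := mul_le_mul_of_nonneg_right h4 (Real.exp_pos (|s - t| * K)).le
  rw [Real.dist_eq]
  exact (_root_.abs_sub_le _ (φ t' x' s) _).trans (add_le_add h1 (h2.trans h5))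

lemma sub_eq_mul_integral (hv : IsRegularField v v' V K) (t a b : ℝ) :
    v t b - v t a = (∫ θ in (0 : ℝ)..1, v' t (a + θ * (b - a))) * (b - a) := by
  have hd : ∀ θ : ℝ, HasDerivAt (fun θ => v t (a + θ * (b - a)))
      (v' t (a + θ * (b - a)) * (b - a)) θ := fun θ => by
    have h1 : HasDerivAt (fun θ : ℝ => a + θ * (b - a)) (b - a) θ := by
      simpa using ((hasDerivAt_id θ).mul_const (b - a)).const_add a
    exact (hv.hasDerivAt t _).comp θ h1
  have hc : Continuous fun θ : ℝ => v' t (a + θ * (b - a)) * (b - a) :=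
    (hv.continuous_deriv.comp (continuous_const.prodMk (by fun_prop))).mul continuous_const
  have := intervalIntegral.integral_eq_sub_of_hasDerivAt (fun θ _ => hd θ)
    (hc.intervalIntegrable 0 1)
  rw [← intervalIntegral.integral_mul_const, this]
  simp

/-- The difference of two trajectories solves a scalar linear equation whose coefficient is the
averaged slope of `v` between them. This exact formula gives differentiability in the starting point
without the variational equation. -/
lemma flow_sub_eq (hv : IsRegularField v v' V K) (hφ : IsFlow v φ) (t x y s : ℝ) :
    φ t y s - φ t x s = (y - x) * Real.exp (∫ r in t..s,
      ∫ θ in (0 : ℝ)..1, v' r (φ t x r + θ * (φ t y r - φ t x r))) := by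
  set q : ℝ → ℝ := fun r => ∫ θ in (0 : ℝ)..1, v' r (φ t x r + θ * (φ t y r - φ t x r)) with hq
  have hcur : ∀ x, Continuous (φ t x) := fun x =>
    (hv.continuous_flow hφ).comp (continuous_const.prodMk (continuous_const.prodMk continuous_id))
  have hqc : Continuous q := by
    refine intervalIntegral.continuous_parametric_intervalIntegral_of_continuous' ?_ 0 1
    have h1 := (hcur x).comp (continuous_fst (X := ℝ) (Y := ℝ))
    have h2 := (hcur y).comp (continuous_fst (X := ℝ) (Y := ℝ))
    exact hv.continuous_deriv.comp
      (continuous_fst.prodMk (h1.add (continuous_snd.mul (h2.sub h1))))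
  have hI : ∀ s, HasDerivAt (fun s => ∫ r in t..s, q r) (q s) s := fun s =>
    intervalIntegral.integral_hasDerivAt_right (hqc.intervalIntegrable _ _)
      (hqc.stronglyMeasurableAtFilter _ _) hqc.continuousAt
  have hd : ∀ s, HasDerivAt (fun s => (φ t y s - φ t x s) * Real.exp (-∫ r in t..s, q r)) 0 s := by
    intro s
    refine (((hφ.hasDerivAt t y s).fun_sub (hφ.hasDerivAt t x s)).fun_mul
      (hI s).fun_neg.exp).congr_deriv ?_
    rw [hv.sub_eq_mul_integral]
    ring
  have hconst := is_const_of_deriv_eq_zero (fun s => (hd s).differentiableAt)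
    (fun s => (hd s).deriv) s t
  simp only [intervalIntegral.integral_same, neg_zero, Real.exp_zero, mul_one, hφ.self] at hconst
  rw [← hconst, mul_assoc, ← Real.exp_add]
  simp

lemma hasDerivAt_flow_space (hv : IsRegularField v v' V K) (hφ : IsFlow v φ) (t x s : ℝ) :
    HasDerivAt (fun x => φ t x s) (Real.exp (∫ r in t..s, v' r (φ t x r))) x := by
  have hc := hv.continuous_flow hφ
  have h := hasDerivAt_of_sub_eq_mul (f := fun x => φ t x s) (x := x) (G := fun y =>
    Real.exp (∫ r in t..s, ∫ θ in (0 : ℝ)..1, v' r (φ t x r + θ * (φ t y r - φ t x r))))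
    (Continuous.continuousAt ?_) (fun y => hv.flow_sub_eq hφ t x y s)
  · simpa using h
  · refine Real.continuous_exp.comp
      (intervalIntegral.continuous_parametric_intervalIntegral_of_continuous' ?_ t s)
    refine intervalIntegral.continuous_parametric_intervalIntegral_of_continuous'
      (f := fun (p : ℝ × ℝ) θ => v' p.2 (φ t x p.2 + θ * (φ t p.1 p.2 - φ t x p.2))) ?_ 0 1
    refine hv.continuous_deriv.comp ((continuous_snd.comp continuous_fst).prodMk ?_)
    have h1 : Continuous fun q : (ℝ × ℝ) × ℝ => φ t x q.1.2 :=
      hc.comp (continuous_const.prodMk (continuous_const.prodMk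
        (continuous_snd.comp continuous_fst)))
    have h2 : Continuous fun q : (ℝ × ℝ) × ℝ => φ t q.1.1 q.1.2 :=
      hc.comp (continuous_const.prodMk continuous_fst)
    fun_prop

/-- The case of coinciding starting and arrival times; `hasDerivAt_flow_time` deduces the general
case from `flow_trans` and the chain rule. -/
lemma hasDerivAt_flow_start (hv : IsRegularField v v' V K) (hφ : IsFlow v φ) (t x : ℝ) :
    HasDerivAt (fun r => φ r x t) (-v t x) t := by
  have hc := hv.continuous_flow hφ
  have h := hasDerivAt_of_sub_eq_mul (f := fun r => φ r x t) (x := t) (G := fun r =>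
    -∫ θ in (0 : ℝ)..1, v (r + θ * (t - r)) (φ r x (r + θ * (t - r))))
    (Continuous.continuousAt ?_) (fun r => ?_)
  · simpa [hφ.self] using h
  · refine (intervalIntegral.continuous_parametric_intervalIntegral_of_continuous' ?_ 0 1).neg
    have h1 : Continuous fun q : ℝ × ℝ => q.1 + q.2 * (t - q.1) := by fun_prop
    exact hv.continuous.comp (h1.prodMk (hc.comp (continuous_fst.prodMk
      (continuous_const.prodMk h1))))
  · have hd : ∀ θ : ℝ, HasDerivAt (fun θ => φ r x (r + θ * (t - r)))
        (v (r + θ * (t - r)) (φ r x (r + θ * (t - r))) * (t - r)) θ := fun θ => by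
      have h1 : HasDerivAt (fun θ : ℝ => r + θ * (t - r)) (t - r) θ := by
        simpa using ((hasDerivAt_id θ).mul_const (t - r)).const_add r
      exact (hφ.hasDerivAt r x _).comp θ h1
    have h1 : Continuous fun θ : ℝ => r + θ * (t - r) := by fun_prop
    have hcont : Continuous fun θ : ℝ =>
        v (r + θ * (t - r)) (φ r x (r + θ * (t - r))) * (t - r) :=
      (hv.continuous.comp (h1.prodMk (hc.comp (continuous_const.prodMk
        (continuous_const.prodMk h1))))).mul continuous_const
    have := intervalIntegral.integral_eq_sub_of_hasDerivAt (fun θ _ => hd θ)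
      (hcont.intervalIntegrable 0 1)
    rw [intervalIntegral.integral_mul_const] at this
    simp only [one_mul, zero_mul, add_zero, add_sub_cancel, hφ.self] at this
    rw [hφ.self]
    linarith

lemma hasDerivAt_flow_time (hv : IsRegularField v v' V K) (hφ : IsFlow v φ) (t x s : ℝ) :
    HasDerivAt (fun t => φ t x s) (-v t x * Real.exp (∫ r in t..s, v' r (φ t x r))) t := by
  have h1 : HasDerivAt (fun y => φ t y s) (Real.exp (∫ r in t..s, v' r (φ t x r))) (φ t x t) := by
    rw [hφ.self]
    exact hv.hasDerivAt_flow_space hφ t x s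
  have h2 := HasDerivAt.comp (h₂ := fun y => φ t y s) (h := fun r => φ r x t) t h1
    (hv.hasDerivAt_flow_start hφ t x)
  refine (h2.congr_deriv (mul_comm _ _)).congr_of_eventuallyEq (Eventually.of_forall fun r => ?_)
  exact (hv.flow_trans hφ r x t s).symm

lemma continuous_flow_deriv (hv : IsRegularField v v' V K) (hφ : IsFlow v φ) (s : ℝ) :
    Continuous fun q : ℝ × ℝ => Real.exp (∫ r in q.1..s, v' r (φ q.1 q.2 r)) := by
  have hc := hv.continuous_flow hφ
  simp_rw [intervalIntegral.integral_symm s]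
  refine Real.continuous_exp.comp (Continuous.neg ?_)
  refine intervalIntegral.continuous_parametric_intervalIntegral_of_continuous
    (f := fun (q : ℝ × ℝ) r => v' r (φ q.1 q.2 r)) ?_ continuous_fst
  exact hv.continuous_deriv.comp (continuous_snd.prodMk (hc.comp
    ((continuous_fst.comp continuous_fst).prodMk
      ((continuous_snd.comp continuous_fst).prodMk continuous_snd))))

/-- Two flows stay close over short times if their vector fields are close. -/
lemma abs_flow_sub_flow_le (hv : IsRegularField v v' V K) (hK : 0 < K) (hφ : IsFlow v φ)
    {w : ℝ → ℝ → ℝ} {ψ : ℝ → ℝ → ℝ → ℝ} (hψ : IsFlow w ψ) {ε : ℝ} (hε : 0 ≤ ε)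
    (hvw : ∀ t x, |v t x - w t x| ≤ ε) {t s : ℝ} (hts : |s - t| * K ≤ 1) (x : ℝ) :
    |φ t x s - ψ t x s| ≤ 2 * (|s - t| * ε) := by
  refine abs_le_two_mul_of_hasDerivAt (h := fun s => φ t x s - ψ t x s) hK hε hts
    (by simp [hφ.self, hψ.self])
    (fun s => (hφ.hasDerivAt t x s).fun_sub (hψ.hasDerivAt t x s)) fun s _ => ?_
  have h1 := hv.abs_sub_le s (φ t x s) (ψ t x s)
  have h2 := hvw s (ψ t x s)
  exact (_root_.abs_sub_le _ (v s (ψ t x s)) _).trans (add_le_add h1 h2)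

end IsRegularField

/-! ### The sweep: separation of the two profiles and the fixed point. -/

/-- The velocity `lam t + Z`, where `Z` is the extended filter of `Y`. -/
noncomputable def velocity (α L : ℝ) (lam : ℝ → ℝ) (Y : ℝ → ℝ → ℝ) (t x : ℝ) : ℝ :=
  lam t + reflectExt L (dirichletFilter α L (Y t)) x

/-- Continuous functions of `(t, x)` bounded by `m` and `M`-Lipschitz in `x` on `[0, L]`. -/
structure IsAdmissible (L m M : ℝ) (Y : ℝ → ℝ → ℝ) : Prop where
  continuous : Continuous fun q : ℝ × ℝ => Y q.1 q.2
  abs_le : ∀ t x, |Y t x| ≤ m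
  abs_sub_le : ∀ t, ∀ x ∈ Icc 0 L, ∀ y ∈ Icc 0 L, |Y t x - Y t y| ≤ M * |x - y|

lemma IsAdmissible.continuous_slice {L m M : ℝ} {Y : ℝ → ℝ → ℝ} (hY : IsAdmissible L m M Y)
    (t : ℝ) : Continuous (Y t) :=
  hY.continuous.comp (continuous_const.prodMk continuous_id)

lemma IsAdmissible.isRegularField {α L m M Λ : ℝ} (hα : 0 < α) (hL : 0 < L) {lam : ℝ → ℝ}
    (hlam : Continuous lam) (hΛ : ∀ t, |lam t| ≤ Λ) {Y : ℝ → ℝ → ℝ} (hY : IsAdmissible L m M Y) :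
    IsRegularField (velocity α L lam Y)
      (fun t x => dirichletFilterDeriv α L (Y t) (foldTo L x) *
        (L / max (max L x) (L - x)) ^ 2) (Λ + 3 * m) M where
  continuous := by
    have h := continuous_dirichletFilter_param (α := α) (L := L) hY.continuous
    have h1 := h.comp (continuous_fst.prodMk ((continuous_clampTo L).comp continuous_snd))
    have h2 := h.comp (continuous_fst.prodMk ((continuous_foldTo hL).comp continuous_snd))
    exact (hlam.comp continuous_fst).add ((continuous_const.mul h1).sub h2)
  continuous_deriv := by
    have h := continuous_dirichletFilterDeriv_param (α := α) (L := L) hY.continuous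
    have h2 := h.comp (continuous_fst.prodMk ((continuous_foldTo hL).comp continuous_snd))
    refine h2.mul ((Continuous.div (by fun_prop) (by fun_prop) fun q => ?_).pow 2)
    exact (scale_pos hL q.2).ne'
  hasDerivAt t x := (hasDerivAt_reflectExt hL
    (hasDerivAt_dirichletFilter (hY.continuous_slice t)) x).const_add (lam t)
  abs_le t x := (abs_add_le _ _).trans (add_le_add (hΛ t) (abs_reflectExt_le hL
    (fun _ hy => abs_dirichletFilter_le hα hL (hY.continuous_slice t)
      (fun z _ => hY.abs_le t z) hy) x))
  abs_deriv_le t x := abs_reflectExt_deriv_le hL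
    (fun _ hy => abs_dirichletFilterDeriv_le hα hL (hY.continuous_slice t) (hY.abs_sub_le t) hy) x

/-- Initial and terminal profiles `f₀`, `f₁` supported near `[0, L]`, and a drift `lam` with
primitive `P` which is strong enough to sweep them across `[0, L]` within time `τ`. -/
structure SweepData (L T τ m Λ : ℝ) (f₀ f₀' f₁ f₁' lam P : ℝ → ℝ) : Prop where
  L_pos : 0 < L
  T_pos : 0 < T
  τ_pos : 0 < τ
  two_τ_le : 2 * τ ≤ T
  m_pos : 0 < m
  small : 12 * m * τ ≤ 1
  hasDerivAt₀ : ∀ x, HasDerivAt f₀ (f₀' x) x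
  hasDerivAt₁ : ∀ x, HasDerivAt f₁ (f₁' x) x
  continuous_deriv₀ : Continuous f₀'
  continuous_deriv₁ : Continuous f₁'
  abs_le₀ : ∀ x, |f₀ x| ≤ m
  abs_le₁ : ∀ x, |f₁ x| ≤ m
  abs_deriv_le₀ : ∀ x, |f₀' x| ≤ m
  abs_deriv_le₁ : ∀ x, |f₁' x| ≤ m
  eq_zero₀ : ∀ x ≤ -1, f₀ x = 0
  eq_zero₁ : ∀ x, L + 1 ≤ x → f₁ x = 0
  continuous_lam : Continuous lam
  abs_lam_le : ∀ t ∈ Icc 0 T, |lam t| ≤ Λ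
  hasDerivAt_primitive : ∀ t ∈ Icc 0 T, HasDerivAt P (lam (clampTo T t)) t
  sweep₀ : ∀ t ∈ Icc τ T, L + 1 + 3 * m * T ≤ P t - P 0
  sweep₁ : ∀ t ∈ Icc 0 (T - τ), L + 1 + 3 * m * T ≤ P T - P t

/-- The sum of the initial profile transported forward and the terminal one transported back. -/
def transported (T : ℝ) (f₀ f₁ : ℝ → ℝ) (φ : ℝ → ℝ → ℝ → ℝ) (t x : ℝ) : ℝ :=
  f₀ (φ t x 0) + f₁ (φ t x T)

namespace SweepData

variable {α L T τ m Λ : ℝ} {f₀ f₀' f₁ f₁' lam P : ℝ → ℝ} {Y : ℝ → ℝ → ℝ} {φ : ℝ → ℝ → ℝ → ℝ}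

lemma isRegularField (D : SweepData L T τ m Λ f₀ f₀' f₁ f₁' lam P) (hα : 0 < α)
    (hY : IsAdmissible L m (2 * m) Y) :
    IsRegularField (velocity α L (fun t => lam (clampTo T t)) Y)
      (fun t x => dirichletFilterDeriv α L (Y t) (foldTo L x) *
        (L / max (max L x) (L - x)) ^ 2) (Λ + 3 * m) (2 * m) :=
  hY.isRegularField hα D.L_pos (D.continuous_lam.comp (continuous_clampTo T))
    (fun t => D.abs_lam_le _ (clampTo_mem D.T_pos t))

/-- Subtracting `P` removes the drift; the remaining velocity is the extended filter, bounded by `3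
* m`. Thus the filter can oppose the sweep by at most `3 * m * T`, the margin built into `sweep₀`
and `sweep₁`. -/
lemma abs_displacement_le (D : SweepData L T τ m Λ f₀ f₀' f₁ f₁' lam P) (hα : 0 < α)
    (hY : IsAdmissible L m (2 * m) Y)
    (hφ : IsFlow (velocity α L (fun t => lam (clampTo T t)) Y) φ) (t x : ℝ) {r s : ℝ}
    (hr : r ∈ Icc 0 T) (hs : s ∈ Icc 0 T) :
    |(φ t x r - P r) - (φ t x s - P s)| ≤ 3 * m * T := by
  have h : |(φ t x r - P r) - (φ t x s - P s)| ≤ 3 * m * |r - s| := by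
    refine abs_sub_le_of_hasDerivAt_of_abs_le (f := fun s => φ t x s - P s) (convex_Icc 0 T)
      (fun u hu => (hφ.hasDerivAt t x u).fun_sub (D.hasDerivAt_primitive u hu))
      (fun u _ => ?_) hr hs
    rw [velocity, add_sub_cancel_left]
    exact abs_reflectExt_le D.L_pos (fun _ hy => abs_dirichletFilter_le hα D.L_pos
      (hY.continuous_slice u) (fun z _ => hY.abs_le u z) hy) _
  have hrs : |r - s| ≤ T := abs_le.2 ⟨by linarith [hr.1, hs.2], by linarith [hr.2, hs.1]⟩
  exact h.trans (mul_le_mul_of_nonneg_left hrs (by linarith [D.m_pos]))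

lemma initial_eq_zero (D : SweepData L T τ m Λ f₀ f₀' f₁ f₁' lam P) (hα : 0 < α)
    (hY : IsAdmissible L m (2 * m) Y)
    (hφ : IsFlow (velocity α L (fun t => lam (clampTo T t)) Y) φ) {t x : ℝ}
    (ht : t ∈ Icc τ T) (hx : x ∈ Icc 0 L) : f₀ (φ t x 0) = 0 := by
  refine D.eq_zero₀ _ ?_
  have h := abs_le.1 (D.abs_displacement_le hα hY hφ t x
    (left_mem_Icc.2 D.T_pos.le) ⟨D.τ_pos.le.trans ht.1, ht.2⟩)
  rw [hφ.self] at h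
  linarith [D.sweep₀ t ht, hx.2, h.2]

lemma terminal_eq_zero (D : SweepData L T τ m Λ f₀ f₀' f₁ f₁' lam P) (hα : 0 < α)
    (hY : IsAdmissible L m (2 * m) Y)
    (hφ : IsFlow (velocity α L (fun t => lam (clampTo T t)) Y) φ) {t x : ℝ}
    (ht : t ∈ Icc 0 (T - τ)) (hx : x ∈ Icc 0 L) : f₁ (φ t x T) = 0 := by
  refine D.eq_zero₁ _ ?_
  have h := abs_le.1 (D.abs_displacement_le hα hY hφ t x
    (right_mem_Icc.2 D.T_pos.le) ⟨ht.1, by linarith [ht.2, D.τ_pos]⟩)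
  rw [hφ.self] at h
  linarith [D.sweep₁ t ht, hx.1, h.1]

/-- On `[0, L]` at most one of the two transported profiles is present at a given time. -/
lemma transported_cases (D : SweepData L T τ m Λ f₀ f₀' f₁ f₁' lam P) (hα : 0 < α)
    {t : ℝ} (ht : t ∈ Icc 0 T) {p : (ℝ → ℝ → ℝ → ℝ) → Prop}
    (hp : ∀ φ, p φ → ∃ Y, IsAdmissible L m (2 * m) Y ∧
      IsFlow (velocity α L (fun t => lam (clampTo T t)) Y) φ) :
    (|0 - t| ≤ τ ∧ ∀ φ, p φ → ∀ x ∈ Icc 0 L, transported T f₀ f₁ φ t x = f₀ (φ t x 0)) ∨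
    (|T - t| ≤ τ ∧ ∀ φ, p φ → ∀ x ∈ Icc 0 L, transported T f₀ f₁ φ t x = f₁ (φ t x T)) ∨
    ∀ φ, p φ → ∀ x ∈ Icc 0 L, transported T f₀ f₁ φ t x = 0 := by
  have h2 := D.two_τ_le
  rcases le_total t τ with h | h
  · refine Or.inl ⟨by rw [abs_le]; constructor <;> linarith [ht.1, D.τ_pos], fun φ hφ x hx => ?_⟩
    obtain ⟨Y, hY, hf⟩ := hp φ hφ
    rw [transported, D.terminal_eq_zero hα hY hf ⟨ht.1, by linarith⟩ hx, add_zero]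
  rcases le_total (T - τ) t with h' | h'
  · refine Or.inr (Or.inl ⟨by rw [abs_le]; constructor <;> linarith [ht.2, D.τ_pos],
      fun φ hφ x hx => ?_⟩)
    obtain ⟨Y, hY, hf⟩ := hp φ hφ
    rw [transported, D.initial_eq_zero hα hY hf ⟨h, ht.2⟩ hx, zero_add]
  · refine Or.inr (Or.inr fun φ hφ x hx => ?_)
    obtain ⟨Y, hY, hf⟩ := hp φ hφ
    rw [transported, D.initial_eq_zero hα hY hf ⟨h, ht.2⟩ hx,
      D.terminal_eq_zero hα hY hf ⟨ht.1, h'⟩ hx, add_zero]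

lemma abs_sub_le₀ (D : SweepData L T τ m Λ f₀ f₀' f₁ f₁' lam P) (x y : ℝ) :
    |f₀ x - f₀ y| ≤ m * |x - y| :=
  abs_sub_le_of_hasDerivAt_of_abs_le convex_univ (fun x _ => D.hasDerivAt₀ x)
    (fun x _ => D.abs_deriv_le₀ x) (mem_univ x) (mem_univ y)

lemma abs_sub_le₁ (D : SweepData L T τ m Λ f₀ f₀' f₁ f₁' lam P) (x y : ℝ) :
    |f₁ x - f₁ y| ≤ m * |x - y| :=
  abs_sub_le_of_hasDerivAt_of_abs_le convex_univ (fun x _ => D.hasDerivAt₁ x)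
    (fun x _ => D.abs_deriv_le₁ x) (mem_univ x) (mem_univ y)

lemma abs_transported_le (D : SweepData L T τ m Λ f₀ f₀' f₁ f₁' lam P) (hα : 0 < α)
    (hY : IsAdmissible L m (2 * m) Y)
    (hφ : IsFlow (velocity α L (fun t => lam (clampTo T t)) Y) φ) {t x : ℝ}
    (ht : t ∈ Icc 0 T) (hx : x ∈ Icc 0 L) : |transported T f₀ f₁ φ t x| ≤ m := by
  rcases D.transported_cases hα ht (p := fun ψ => ψ = φ)
    (fun ψ hψ => ⟨Y, hY, hψ ▸ hφ⟩) with ⟨_, h⟩ | ⟨_, h⟩ | h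
  · rw [h φ rfl x hx]; exact D.abs_le₀ _
  · rw [h φ rfl x hx]; exact D.abs_le₁ _
  · rw [h φ rfl x hx, abs_zero]; exact D.m_pos.le

lemma exp_le_two (D : SweepData L T τ m Λ f₀ f₀' f₁ f₁' lam P) {s : ℝ} (hs : |s| ≤ τ) :
    Real.exp (|s| * (2 * m)) ≤ 2 := by
  have h0 : 0 ≤ |s| * (2 * m) := mul_nonneg (abs_nonneg s) (by linarith [D.m_pos])
  have h1 : |s| * (2 * m) ≤ 1 / 6 := by
    have := mul_le_mul_of_nonneg_right hs (by linarith [D.m_pos] : 0 ≤ 2 * m)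
    linarith [D.small]
  have := Real.abs_exp_sub_one_sub_id_le (x := |s| * (2 * m)) (by rw [abs_of_nonneg h0]; linarith)
  nlinarith [(abs_le.1 this).2]

/-- The profile contributes Lipschitz constant `m`, and the flow over a time at most `τ` stretches
distances by at most 2. So the class with constant `2 * m` is preserved. -/
lemma abs_transported_sub_le (D : SweepData L T τ m Λ f₀ f₀' f₁ f₁' lam P) (hα : 0 < α)
    (hY : IsAdmissible L m (2 * m) Y)
    (hφ : IsFlow (velocity α L (fun t => lam (clampTo T t)) Y) φ) {t x y : ℝ}
    (ht : t ∈ Icc 0 T) (hx : x ∈ Icc 0 L) (hy : y ∈ Icc 0 L) :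
    |transported T f₀ f₁ φ t x - transported T f₀ f₁ φ t y| ≤ 2 * m * |x - y| := by
  have hm := D.m_pos
  have key : ∀ s, |s - t| ≤ τ → m * |φ t x s - φ t y s| ≤ 2 * m * |x - y| := fun s hs => by
    have h1 := (D.isRegularField hα hY).abs_flow_sub_le hφ t x y s
    have h2 := mul_le_mul_of_nonneg_left (D.exp_le_two hs) (abs_nonneg (x - y))
    have h3 := mul_le_mul_of_nonneg_left (h1.trans h2) hm.le
    linarith
  rcases D.transported_cases hα ht (p := fun ψ => ψ = φ)
    (fun ψ hψ => ⟨Y, hY, hψ ▸ hφ⟩) with ⟨hs, h⟩ | ⟨hs, h⟩ | h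
  · rw [h φ rfl x hx, h φ rfl y hy]
    exact (D.abs_sub_le₀ _ _).trans (key 0 hs)
  · rw [h φ rfl x hx, h φ rfl y hy]
    exact (D.abs_sub_le₁ _ _).trans (key T hs)
  · rw [h φ rfl x hx, h φ rfl y hy, sub_zero, abs_zero]
    positivity

/-- The contraction estimate: the velocities differ by at most `3 * d`, the flows by `6 * τ * d`
over a time at most `τ`, the profiles by `6 * m * τ * d`, and `12 * m * τ ≤ 1`. -/
lemma abs_transported_sub_transported_le (D : SweepData L T τ m Λ f₀ f₀' f₁ f₁' lam P)
    (hα : 0 < α) (hY : IsAdmissible L m (2 * m) Y)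
    (hφ : IsFlow (velocity α L (fun t => lam (clampTo T t)) Y) φ)
    {Z : ℝ → ℝ → ℝ} {ψ : ℝ → ℝ → ℝ → ℝ} (hZ : IsAdmissible L m (2 * m) Z)
    (hψ : IsFlow (velocity α L (fun t => lam (clampTo T t)) Z) ψ) {d : ℝ} (hd : 0 ≤ d)
    (hYZ : ∀ t x, |Y t x - Z t x| ≤ d) {t x : ℝ}
    (ht : t ∈ Icc 0 T) (hx : x ∈ Icc 0 L) :
    |transported T f₀ f₁ φ t x - transported T f₀ f₁ ψ t x| ≤ 1 / 2 * d := by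
  have hm := D.m_pos
  have hv : ∀ t x, |velocity α L (fun t => lam (clampTo T t)) Y t x -
      velocity α L (fun t => lam (clampTo T t)) Z t x| ≤ 3 * d := fun t x => by
    rw [velocity, velocity, add_sub_add_left_eq_sub]
    exact abs_reflectExt_sub_le D.L_pos (fun y hy => abs_dirichletFilter_sub_le hα D.L_pos
      (hY.continuous_slice t) (hZ.continuous_slice t) (fun z _ => hYZ t z) hy) x
  have key : ∀ s, |s - t| ≤ τ → m * |φ t x s - ψ t x s| ≤ 1 / 2 * d := fun s hs => by
    have h0 : |s - t| * (2 * m) ≤ 1 := by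
      have := mul_le_mul_of_nonneg_right hs (by linarith : 0 ≤ 2 * m)
      linarith [D.small]
    have h1 := (D.isRegularField hα hY).abs_flow_sub_flow_le (by linarith) hφ hψ
      (by linarith : 0 ≤ 3 * d) hv h0 x
    have h2 : m * |φ t x s - ψ t x s| ≤ m * (2 * (τ * (3 * d))) := by
      gcongr
      exact h1.trans (by gcongr)
    have h3 := mul_le_mul_of_nonneg_right D.small hd
    linarith
  -- A predicate covering both flows puts them in the same case, so profiles of the same kind are
  -- compared.
  rcases D.transported_cases hα ht (p := fun χ => χ = φ ∨ χ = ψ) (by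
    rintro χ (rfl | rfl)
    exacts [⟨Y, hY, hφ⟩, ⟨Z, hZ, hψ⟩]) with ⟨hs, h⟩ | ⟨hs, h⟩ | h
  · rw [h φ (.inl rfl) x hx, h ψ (.inr rfl) x hx]
    exact (D.abs_sub_le₀ _ _).trans (key 0 hs)
  · rw [h φ (.inl rfl) x hx, h ψ (.inr rfl) x hx]
    exact (D.abs_sub_le₁ _ _).trans (key T hs)
  · rw [h φ (.inl rfl) x hx, h ψ (.inr rfl) x hx, sub_zero, abs_zero]
    positivity

lemma continuous_transported (D : SweepData L T τ m Λ f₀ f₀' f₁ f₁' lam P) (hα : 0 < α)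
    (hY : IsAdmissible L m (2 * m) Y)
    (hφ : IsFlow (velocity α L (fun t => lam (clampTo T t)) Y) φ) :
    Continuous fun q : ℝ × ℝ => transported T f₀ f₁ φ q.1 q.2 := by
  have hc := (D.isRegularField hα hY).continuous_flow hφ
  have h0 : Continuous f₀ := continuous_iff_continuousAt.2 fun x => (D.hasDerivAt₀ x).continuousAt
  have h1 : Continuous f₁ := continuous_iff_continuousAt.2 fun x => (D.hasDerivAt₁ x).continuousAt
  exact (h0.comp (hc.comp (continuous_fst.prodMk (continuous_snd.prodMk continuous_const)))).add
    (h1.comp (hc.comp (continuous_fst.prodMk (continuous_snd.prodMk continuous_const))))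

/-- The transport by the flow which a profile generates has a fixed point. -/
theorem exists_fixed_profile (D : SweepData L T τ m Λ f₀ f₀' f₁ f₁' lam P) (hα : 0 < α) :
    ∃ Y φ, IsAdmissible L m (2 * m) Y ∧
      IsFlow (velocity α L (fun t => lam (clampTo T t)) Y) φ ∧
      ∀ t ∈ Icc 0 T, ∀ x ∈ Icc 0 L, Y t x = transported T f₀ f₁ φ t x := by
  have hm := D.m_pos
  -- The Lipschitz bound is a closed condition for uniform convergence, so `S` is complete for the
  -- sup distance and contraction in that distance suffices.
  let S : Set (ℝ × ℝ →ᵇ ℝ) := {Y | (∀ q, |Y q| ≤ m) ∧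
    ∀ t, ∀ x ∈ Icc 0 L, ∀ y ∈ Icc 0 L, |Y (t, x) - Y (t, y)| ≤ 2 * m * |x - y|}
  have hSc : IsClosed S := by
    simp only [S, ofPred_and, ofPred_forall]
    refine (isClosed_iInter fun q => ?_).inter (isClosed_iInter fun t => isClosed_iInter fun x =>
      isClosed_iInter fun _ => isClosed_iInter fun y => isClosed_iInter fun _ => ?_)
    · exact isClosed_le (continuous_eval_const q).abs continuous_const
    · exact isClosed_le ((continuous_eval_const _).sub (continuous_eval_const _)).abs
        continuous_const
  have hadm : ∀ Y : S, IsAdmissible L m (2 * m) fun t x => Y.1 (t, x) := fun Y =>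
    ⟨Y.1.continuous, fun t x => Y.2.1 (t, x), Y.2.2⟩
  choose φ hφ using fun Y : S => (D.isRegularField hα (hadm Y)).exists_isFlow
  let F : S → S := fun Y => ⟨BoundedContinuousFunction.ofNormedAddCommGroup
    -- Clamping makes the image globally bounded and leaves the values on `[0, T] × [0, L]`
    -- unchanged.
    (fun q : ℝ × ℝ => transported T f₀ f₁ (φ Y) (clampTo T q.1) (clampTo L q.2))
    ((D.continuous_transported hα (hadm Y) (hφ Y)).comp
      (((continuous_clampTo T).comp continuous_fst).prodMk
        ((continuous_clampTo L).comp continuous_snd))) m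
    (fun q => D.abs_transported_le hα (hadm Y) (hφ Y) (clampTo_mem D.T_pos _)
      (clampTo_mem D.L_pos _)),
    fun q => D.abs_transported_le hα (hadm Y) (hφ Y) (clampTo_mem D.T_pos _)
      (clampTo_mem D.L_pos _),
    fun t x hx y hy => by
      have := D.abs_transported_sub_le hα (hadm Y) (hφ Y) (clampTo_mem D.T_pos t) hx hy
      simpa [clampTo_of_mem hx, clampTo_of_mem hy] using this⟩
  have hF : ContractingWith (1 / 2) F := by
    refine ⟨by norm_num, LipschitzWith.of_dist_le_mul fun Y Z => ?_⟩
    refine (BoundedContinuousFunction.dist_le (by positivity)).2 fun q => ?_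
    have := D.abs_transported_sub_transported_le hα (hadm Y) (hφ Y) (hadm Z) (hφ Z)
      (d := dist Y Z) dist_nonneg (fun t x => by
        simpa [Real.dist_eq, Subtype.dist_eq] using
          BoundedContinuousFunction.dist_coe_le_dist (f := Y.1) (g := Z.1) (t, x))
      (clampTo_mem D.T_pos q.1) (clampTo_mem D.L_pos q.2)
    simpa [F, Real.dist_eq] using this
  have : CompleteSpace S := hSc.completeSpace_coe
  have : Nonempty S := ⟨⟨0, fun q => by simpa using hm.le, fun t x _ y _ => by simp; positivity⟩⟩
  have hfix : F hF.fixedPoint = hF.fixedPoint := hF.fixedPoint_isFixedPt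
  refine ⟨fun t x => hF.fixedPoint.1 (t, x), φ hF.fixedPoint, hadm _, hφ _, fun t ht x hx => ?_⟩
  have h := congrArg (fun Y : S => Y.1 (t, x)) hfix
  beta_reduce
  rw [← h]
  simp [F, clampTo_of_mem ht, clampTo_of_mem hx]

end SweepData

/-! ### From the fixed point to a controlled solution with uniform bounds. -/

/-- The space derivative of `transported T f₀ f₁ φ`, where `φ` is the flow of a field with space
derivative `v'`, and `f₀'`, `f₁'` are the derivatives of `f₀`, `f₁`. -/
noncomputable def transportedDeriv (T : ℝ) (f₀' f₁' : ℝ → ℝ) (v' : ℝ → ℝ → ℝ)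
    (φ : ℝ → ℝ → ℝ → ℝ) (t x : ℝ) : ℝ :=
  f₀' (φ t x 0) * Real.exp (∫ r in t..0, v' r (φ t x r)) +
    f₁' (φ t x T) * Real.exp (∫ r in t..T, v' r (φ t x r))

namespace IsRegularField

variable {v v' : ℝ → ℝ → ℝ} {V K T : ℝ} {φ : ℝ → ℝ → ℝ → ℝ} {f₀ f₀' f₁ f₁' : ℝ → ℝ}

lemma hasDerivAt_transported_space (hv : IsRegularField v v' V K) (hφ : IsFlow v φ)
    (h₀ : ∀ x, HasDerivAt f₀ (f₀' x) x) (h₁ : ∀ x, HasDerivAt f₁ (f₁' x) x) (t x : ℝ) :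
    HasDerivAt (transported T f₀ f₁ φ t) (transportedDeriv T f₀' f₁' v' φ t x) x :=
  (HasDerivAt.comp (h := fun x => φ t x 0) x (h₀ _) (hv.hasDerivAt_flow_space hφ t x 0)).add
    (HasDerivAt.comp (h := fun x => φ t x T) x (h₁ _) (hv.hasDerivAt_flow_space hφ t x T))

lemma hasDerivAt_transported_time (hv : IsRegularField v v' V K) (hφ : IsFlow v φ)
    (h₀ : ∀ x, HasDerivAt f₀ (f₀' x) x) (h₁ : ∀ x, HasDerivAt f₁ (f₁' x) x) (t x : ℝ) :
    HasDerivAt (fun t => transported T f₀ f₁ φ t x)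
      (-v t x * transportedDeriv T f₀' f₁' v' φ t x) t := by
  refine ((HasDerivAt.comp (h := fun t => φ t x 0) t (h₀ _)
    (hv.hasDerivAt_flow_time hφ t x 0)).add
    (HasDerivAt.comp (h := fun t => φ t x T) t (h₁ _)
      (hv.hasDerivAt_flow_time hφ t x T))).congr_deriv ?_
  rw [transportedDeriv]
  ring

lemma continuous_transportedDeriv (hv : IsRegularField v v' V K) (hφ : IsFlow v φ)
    (h₀ : Continuous f₀') (h₁ : Continuous f₁') :
    Continuous fun q : ℝ × ℝ => transportedDeriv T f₀' f₁' v' φ q.1 q.2 := by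
  have hc := hv.continuous_flow hφ
  exact ((h₀.comp (hc.comp (continuous_fst.prodMk (continuous_snd.prodMk continuous_const)))).mul
    (hv.continuous_flow_deriv hφ 0)).add
    ((h₁.comp (hc.comp (continuous_fst.prodMk (continuous_snd.prodMk continuous_const)))).mul
    (hv.continuous_flow_deriv hφ T))

end IsRegularField

/-- A function on `[0, T] × [0, L]` which is Lipschitz in each variable is Lipschitz. -/
lemma norm_sub_le_of_partial_lipschitz {T L A B : ℝ} {f : ℝ × ℝ → ℝ} (hA : 0 ≤ A) (hB : 0 ≤ B)
    (ht : ∀ x ∈ Icc 0 L, ∀ t ∈ Icc 0 T, ∀ s ∈ Icc 0 T, |f (t, x) - f (s, x)| ≤ A * |t - s|)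
    (hx : ∀ t ∈ Icc 0 T, ∀ x ∈ Icc 0 L, ∀ y ∈ Icc 0 L, |f (t, x) - f (t, y)| ≤ B * |x - y|)
    {p q : ℝ × ℝ} (hp : p ∈ Icc 0 T ×ˢ Icc 0 L) (hq : q ∈ Icc 0 T ×ˢ Icc 0 L) :
    |f p - f q| ≤ (A + B) * ‖p - q‖ := by
  have h1 := ht p.2 hp.2 p.1 hp.1 q.1 hq.1
  have h2 := hx q.1 hq.1 p.2 hp.2 q.2 hq.2
  have h3 : |p.1 - q.1| ≤ ‖p - q‖ := norm_fst_le (p - q)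
  have h4 : |p.2 - q.2| ≤ ‖p - q‖ := norm_snd_le (p - q)
  have h5 := mul_le_mul_of_nonneg_left h3 hA
  have h6 := mul_le_mul_of_nonneg_left h4 hB
  have h7 := abs_sub_le (f p) (f (q.1, p.2)) (f q)
  change |f p - f (q.1, p.2)| ≤ _ at h1
  change |f (q.1, p.2) - f q| ≤ _ at h2
  linarith

namespace SweepData

variable {L T τ m Λ : ℝ} {f₀ f₀' f₁ f₁' lam P : ℝ → ℝ}

/-- A sweep drives the initial profile to the terminal one, with bounds independent of `α`. -/
theorem exists_controlled_solution (D : SweepData L T τ m Λ f₀ f₀' f₁ f₁' lam P) {lam' : ℝ → ℝ}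
    {Λ' : ℝ} (hlam : ∀ t, HasDerivAt lam (lam' t) t) (hlamc : ContDiff ℝ 1 lam)
    (hlam0 : lam 0 = 0) (hlamT : lam T = 0)
    (hlam' : Continuous lam') (hΛ' : ∀ t ∈ Icc 0 T, |lam' t| ≤ Λ') {α : ℝ} (hα : 0 < α) :
    ∃ (p vl vr : ℝ → ℝ) (y z : ℝ × ℝ → ℝ),
      ContinuousOn p (Icc 0 T) ∧
      ContDiffOn ℝ 1 vl (Icc 0 T) ∧
      ContDiffOn ℝ 1 vr (Icc 0 T) ∧
      IsBurgersAlphaSolution α L T f₀ p vl vr y z ∧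
      (∀ x ∈ Ioo 0 L, y (T, x) = f₁ x) ∧
      c1Norm (Icc 0 T ×ˢ Icc 0 L) (fun q => (z q, y q)) + c0Norm (Icc 0 T) p +
        c1Norm (Icc 0 T) (fun t => (vl t, vr t)) ≤
      ENNReal.ofReal ((Λ + m) + (Λ' + (Λ + 3 * m) * (2 * m) + 2 * m)) + ENNReal.ofReal Λ' +
        ENNReal.ofReal ((Λ + m) + (Λ' + (Λ + 3 * m) * (2 * m))) := by
  obtain ⟨Y, φ, hY, hφ, hYφ⟩ := D.exists_fixed_profile hα
  have hm := D.m_pos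
  have hL := D.L_pos
  have hT := D.T_pos
  have h0T : (0 : ℝ) ∈ Icc 0 T := left_mem_Icc.2 hT.le
  have hTT : T ∈ Icc 0 T := right_mem_Icc.2 hT.le
  have h0L : (0 : ℝ) ∈ Icc 0 L := left_mem_Icc.2 hL.le
  have hLL : L ∈ Icc 0 L := right_mem_Icc.2 hL.le
  have hΛ0 : 0 ≤ Λ := (abs_nonneg _).trans (D.abs_lam_le 0 h0T)
  have hΛ'0 : 0 ≤ Λ' := (abs_nonneg _).trans (hΛ' 0 h0T)
  have hv := D.isRegularField hα hY
  set v := velocity α L (fun t => lam (clampTo T t)) Y with hvdef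
  set v' : ℝ → ℝ → ℝ := fun t x => dirichletFilterDeriv α L (Y t) (foldTo L x) *
    (L / max (max L x) (L - x)) ^ 2
  set U : ℝ → ℝ → ℝ := transported T f₀ f₁ φ with hU
  set Ux : ℝ → ℝ → ℝ := transportedDeriv T f₀' f₁' v' φ with hUx
  have hUc : Continuous fun q : ℝ × ℝ => U q.1 q.2 := D.continuous_transported hα hY hφ
  have hUxc : Continuous fun q : ℝ × ℝ => Ux q.1 q.2 :=
    hv.continuous_transportedDeriv hφ D.continuous_deriv₀ D.continuous_deriv₁
  have hUtc : Continuous fun q : ℝ × ℝ => -v q.1 q.2 * Ux q.1 q.2 := hv.continuous.neg.mul hUxc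
  have hdx : ∀ t x, HasDerivAt (U t) (Ux t x) x :=
    hv.hasDerivAt_transported_space hφ D.hasDerivAt₀ D.hasDerivAt₁
  have hdt : ∀ t x, HasDerivAt (fun s => U s x) (-v t x * Ux t x) t :=
    hv.hasDerivAt_transported_time hφ D.hasDerivAt₀ D.hasDerivAt₁
  have hUslice : ∀ t, Continuous (U t) := fun t =>
    hUc.comp (continuous_const.prodMk continuous_id)
  have hU1 : ContDiff ℝ 1 fun q : ℝ × ℝ => U q.1 q.2 :=
    contDiff_one_of_partial_derivs hdt hdx hUtc hUxc
  -- The state is built from `U`, which is `C¹` on the whole plane, whereas the fixed point `Y` is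
  -- only known to be continuous.
  have hZ1 : ContDiff ℝ 1 fun q : ℝ × ℝ => dirichletFilter α L (U q.1) q.2 :=
    contDiff_dirichletFilter_param hdt hUc hUtc
  have hlam1 : ContDiff ℝ 1 fun q : ℝ × ℝ => lam q.1 := hlamc.comp contDiff_fst
  have hUle : ∀ t ∈ Icc 0 T, ∀ x ∈ Icc 0 L, |U t x| ≤ m := fun t ht x hx =>
    D.abs_transported_le hα hY hφ ht hx
  have hUlip : ∀ t ∈ Icc 0 T, ∀ x ∈ Icc 0 L, ∀ y ∈ Icc 0 L,
      |U t x - U t y| ≤ 2 * m * |x - y| := fun t ht x hx y hy =>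
    D.abs_transported_sub_le hα hY hφ ht hx hy
  have hUxle : ∀ t ∈ Icc 0 T, ∀ x ∈ Icc 0 L, |Ux t x| ≤ 2 * m := fun t ht x hx =>
    abs_deriv_le_of_abs_sub_le hL (hdx t) (hUxc.comp (continuous_const.prodMk continuous_id))
      (hUlip t ht) hx
  have hUtlip : ∀ x ∈ Icc 0 L, ∀ t ∈ Icc 0 T, ∀ s ∈ Icc 0 T,
      |U t x - U s x| ≤ (Λ + 3 * m) * (2 * m) * |t - s| := fun x hx t ht s hs => by
    refine abs_sub_le_of_hasDerivAt_of_abs_le (f := fun t => U t x) (convex_Icc 0 T)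
      (fun t _ => hdt t x) (fun t ht => ?_) ht hs
    rw [abs_mul, abs_neg]
    exact mul_le_mul (hv.abs_le t x) (hUxle t ht x hx) (abs_nonneg _) (by positivity)
  have hZle : ∀ t ∈ Icc 0 T, ∀ x ∈ Icc 0 L, |dirichletFilter α L (U t) x| ≤ m :=
    fun t ht x hx => abs_dirichletFilter_le hα hL (hUslice t) (hUle t ht) hx
  have hZlip : ∀ t ∈ Icc 0 T, ∀ x ∈ Icc 0 L, ∀ y ∈ Icc 0 L,
      |dirichletFilter α L (U t) x - dirichletFilter α L (U t) y| ≤ 2 * m * |x - y| :=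
    fun t ht x hx y hy => abs_dirichletFilter_apply_sub_le hα hL (hUslice t) (hUlip t ht) hx hy
  have hZtlip : ∀ x ∈ Icc 0 L, ∀ t ∈ Icc 0 T, ∀ s ∈ Icc 0 T,
      |dirichletFilter α L (U t) x - dirichletFilter α L (U s) x| ≤
        (Λ + 3 * m) * (2 * m) * |t - s| := fun x hx t ht s hs =>
    abs_dirichletFilter_sub_le hα hL (hUslice t) (hUslice s)
      (fun y hy => hUtlip y hy t ht s hs) hx
  have hlamlip : ∀ t ∈ Icc 0 T, ∀ s ∈ Icc 0 T, |lam t - lam s| ≤ Λ' * |t - s| :=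
    fun t ht s hs => abs_sub_le_of_hasDerivAt_of_abs_le (convex_Icc 0 T)
      (fun t _ => hlam t) hΛ' ht hs
  -- `Y` and `U` agree on `[0, T] × [0, L]`, which is all the filter sees, so there the velocity
  -- generated by `Y` is the one the equation requires.
  have hveq : ∀ t ∈ Icc 0 T, ∀ x ∈ Icc 0 L, v t x = lam t + dirichletFilter α L (U t) x := by
    intro t ht x hx
    rw [hvdef, velocity, reflectExt_of_mem hx, clampTo_of_mem ht,
      dirichletFilter_congr hα hL (hY.continuous_slice t) (hUslice t)
        (fun y hy => hYφ t ht y hy) hx]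
  set y : ℝ × ℝ → ℝ := fun q => lam q.1 + U q.1 q.2 with hy
  set z : ℝ × ℝ → ℝ := fun q => lam q.1 + dirichletFilter α L (U q.1) q.2 with hz
  have hy1 : ContDiff ℝ 1 y := hlam1.add hU1
  have hz1 : ContDiff ℝ 1 z := hlam1.add hZ1
  have hvl : ContDiff ℝ 1 fun t => y (t, 0) := hy1.comp (contDiff_id.prodMk contDiff_const)
  have hvr : ContDiff ℝ 1 fun t => y (t, L) := hy1.comp (contDiff_id.prodMk contDiff_const)
  have hyle : ∀ t ∈ Icc 0 T, ∀ x ∈ Icc 0 L, |y (t, x)| ≤ Λ + m := fun t ht x hx =>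
    (abs_add_le _ _).trans (add_le_add (D.abs_lam_le t ht) (hUle t ht x hx))
  have hzle : ∀ t ∈ Icc 0 T, ∀ x ∈ Icc 0 L, |z (t, x)| ≤ Λ + m := fun t ht x hx =>
    (abs_add_le _ _).trans (add_le_add (D.abs_lam_le t ht) (hZle t ht x hx))
  have hytlip : ∀ x ∈ Icc 0 L, ∀ t ∈ Icc 0 T, ∀ s ∈ Icc 0 T,
      |y (t, x) - y (s, x)| ≤ (Λ' + (Λ + 3 * m) * (2 * m)) * |t - s| := fun x hx t ht s hs => by
    rw [hy, add_mul]
    beta_reduce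
    rw [add_sub_add_comm]
    exact (abs_add_le _ _).trans (add_le_add (hlamlip t ht s hs) (hUtlip x hx t ht s hs))
  have hztlip : ∀ x ∈ Icc 0 L, ∀ t ∈ Icc 0 T, ∀ s ∈ Icc 0 T,
      |z (t, x) - z (s, x)| ≤ (Λ' + (Λ + 3 * m) * (2 * m)) * |t - s| := fun x hx t ht s hs => by
    rw [hz, add_mul]
    beta_reduce
    rw [add_sub_add_comm]
    exact (abs_add_le _ _).trans (add_le_add (hlamlip t ht s hs) (hZtlip x hx t ht s hs))
  have hylip : ∀ t ∈ Icc 0 T, ∀ x ∈ Icc 0 L, ∀ x' ∈ Icc 0 L,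
      |y (t, x) - y (t, x')| ≤ 2 * m * |x - x'| := fun t ht x hx x' hx' => by
    rw [hy]
    beta_reduce
    rw [add_sub_add_left_eq_sub]
    exact hUlip t ht x hx x' hx'
  have hzlip : ∀ t ∈ Icc 0 T, ∀ x ∈ Icc 0 L, ∀ x' ∈ Icc 0 L,
      |z (t, x) - z (t, x')| ≤ 2 * m * |x - x'| := fun t ht x hx x' hx' => by
    rw [hz]
    beta_reduce
    rw [add_sub_add_left_eq_sub]
    exact hZlip t ht x hx x' hx'
  have hNt : 0 ≤ Λ' + (Λ + 3 * m) * (2 * m) := by positivity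
  have hIcl : Icc 0 T ⊆ closure (interior (Icc 0 T)) := by
    rw [interior_Icc, closure_Ioo hT.ne]
  refine ⟨lam', fun t => y (t, 0), fun t => y (t, L), y, z, hlam'.continuousOn, hvl.contDiffOn,
    hvr.contDiffOn, ⟨hy1.contDiffOn, hz1.contDiffOn, fun t _ => ?_, fun t ht x hx => ?_,
      fun t ht x hx => ?_, fun t _ => ⟨?_, rfl⟩, fun t _ => ⟨?_, rfl⟩, fun x hx => ?_⟩,
    fun x hx => ?_, add_le_add (add_le_add ?_ ?_) ?_⟩
  · exact ((contDiff_const (c := lam t)).add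
      (contDiff_two_dirichletFilter (α := α) (L := L) (hUslice t))).contDiffOn
  -- Since `U_t = -v * U_x` and `z = v` here, the equation leaves only `lam' t`, the control.
  · rw [((hlam t).fun_add (hdt t x)).deriv, ((hdx t x).const_add (lam t)).deriv,
      hveq t (Ioo_subset_Icc_self ht) x (Ioo_subset_Icc_self hx)]
    ring
  · have h1 : deriv (fun ξ => z (t, ξ)) = dirichletFilterDeriv α L (U t) :=
      funext fun ξ => ((hasDerivAt_dirichletFilter (hUslice t) ξ).const_add (lam t)).deriv
    rw [h1, (hasDerivAt_dirichletFilterDeriv (hUslice t) x).deriv]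
    simp only [hz, hy]
    field_simp
    ring
  · simp only [hz, hy, dirichletFilter_zero]
  · simp only [hz, hy, dirichletFilter_right hα hL]
  -- At time `0` the terminal profile is still outside `[0, L]` and `lam 0 = 0`, so only `f₀`
  -- remains; at time `T` the roles are exchanged.
  · have h1 : f₁ (φ 0 x T) = 0 := D.terminal_eq_zero hα hY hφ
      ⟨le_rfl, by linarith [D.two_τ_le, D.τ_pos]⟩ (Ioo_subset_Icc_self hx)
    simp only [hy, hU, transported, h1, hφ.self, hlam0, zero_add, add_zero]
  · have h1 : f₀ (φ T x 0) = 0 := D.initial_eq_zero hα hY hφ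
      ⟨by linarith [D.two_τ_le, D.τ_pos], le_rfl⟩ (Ioo_subset_Icc_self hx)
    simp only [hy, hU, transported, h1, hφ.self, hlamT, zero_add]
  · refine c1Norm_le_of_lipschitz ?_ ((uniqueDiffOn_Icc hT).prod (uniqueDiffOn_Icc hL))
      (hz1.prodMk hy1) (by positivity) (by positivity) (fun q hq => ?_) (fun q hq r hr => ?_)
    · rw [interior_prod_eq, interior_Icc, interior_Icc, closure_prod_eq, closure_Ioo hT.ne,
        closure_Ioo hL.ne]
    · exact max_le (hzle q.1 hq.1 q.2 hq.2) (hyle q.1 hq.1 q.2 hq.2)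
    · exact max_le
        (norm_sub_le_of_partial_lipschitz hNt (by positivity) hztlip hzlip hq hr)
        (norm_sub_le_of_partial_lipschitz hNt (by positivity) hytlip hylip hq hr)
  · refine iSup₂_le fun t ht => ?_
    rw [← ofReal_norm]
    exact ENNReal.ofReal_le_ofReal (hΛ' t ht)
  · refine c1Norm_le_of_lipschitz hIcl (uniqueDiffOn_Icc hT) (hvl.prodMk hvr) (by positivity)
      hNt (fun t ht => ?_) (fun t ht s hs => ?_)
    · exact max_le (hyle t ht 0 h0L) (hyle t ht L hLL)
    · exact max_le (hytlip 0 h0L t ht s hs) (hytlip L hLL t ht s hs)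

end SweepData

/-! ### Choice of the drift and conclusion. -/

lemma IsBurgersAlphaSolution.congr_initial {α L T : ℝ} {f g p vl vr : ℝ → ℝ} {y z : ℝ × ℝ → ℝ}
    (h : IsBurgersAlphaSolution α L T f p vl vr y z) (hfg : ∀ x ∈ Ioo 0 L, f x = g x) :
    IsBurgersAlphaSolution α L T g p vl vr y z :=
  { h with initial := fun x hx => (h.initial x hx).trans (hfg x hx) }

/-- The right side is the integral of `s * (T - s)` over `[0, t]`. This lower bound fixes how large
the drift amplitude `c` must be. -/
lemma le_cubic_of_mem {T τ t : ℝ} (hτ : 0 ≤ τ) (ht : t ∈ Icc τ T) :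
    T * τ ^ 2 / 6 ≤ T * t ^ 2 / 2 - t ^ 3 / 3 := by
  have h0 : 0 ≤ t := hτ.trans ht.1
  have h1 : τ ^ 2 ≤ t ^ 2 := pow_le_pow_left₀ hτ ht.1 2
  have h2 : t ^ 3 ≤ T * t ^ 2 := by
    have := mul_le_mul_of_nonneg_right ht.2 (sq_nonneg t)
    linarith [pow_succ' t 2]
  have h3 := mul_le_mul_of_nonneg_left h1 (h0.trans ht.2)
  linarith

theorem theorem1 (L T : ℝ) (hL : 0 < L) (hT : 0 < T) (y₀ yT : ℝ → ℝ)
    (hy₀ : ContDiffOn ℝ 1 y₀ (Icc 0 L)) (hyT : ContDiffOn ℝ 1 yT (Icc 0 L)) :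
    ∃ C : ℝ, 0 < C ∧ ∀ α : ℝ, 0 < α →
      ∃ (p vl vr : ℝ → ℝ) (y z : ℝ × ℝ → ℝ),
        ContinuousOn p (Icc 0 T) ∧
        ContDiffOn ℝ 1 vl (Icc 0 T) ∧
        ContDiffOn ℝ 1 vr (Icc 0 T) ∧
        IsBurgersAlphaSolution α L T y₀ p vl vr y z ∧
        (∀ x ∈ Ioo 0 L, y (T, x) = yT x) ∧
        c1Norm (Icc 0 T ×ˢ Icc 0 L) (fun q => (z q, y q)) + c0Norm (Icc 0 T) p +
          c1Norm (Icc 0 T) (fun t => (vl t, vr t)) ≤ ENNReal.ofReal C := by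
  obtain ⟨f₀, f₀', m₀, hm₀, hd₀, hc₀, he₀, hz₀, -, hb₀, hb₀'⟩ :=
    exists_compactly_supported_extension hL hy₀
  obtain ⟨f₁, f₁', m₁, hm₁, hd₁, hc₁, he₁, -, hz₁, hb₁, hb₁'⟩ :=
    exists_compactly_supported_extension hL hyT
  obtain ⟨m, hm, h₀m, h₁m⟩ : ∃ m, 0 < m ∧ m₀ ≤ m ∧ m₁ ≤ m :=
    ⟨max m₀ m₁, hm₀.trans_le (le_max_left _ _), le_max_left _ _, le_max_right _ _⟩
  obtain ⟨τ, hτ, hτT, hτm⟩ : ∃ τ, 0 < τ ∧ 2 * τ ≤ T ∧ 12 * m * τ ≤ 1 := by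
    refine ⟨min (T / 2) (1 / (12 * m)), by positivity, ?_, ?_⟩
    · linarith [min_le_left (T / 2) (1 / (12 * m))]
    · have := mul_le_mul_of_nonneg_left (min_le_right (T / 2) (1 / (12 * m)))
        (by positivity : 0 ≤ 12 * m)
      rwa [mul_one_div_cancel (by positivity)] at this
  -- The amplitude is tuned so that the drift alone covers `L + 1 + 3 * m * T` by time `τ`; it is
  -- chosen before `α`.
  obtain ⟨c, hc, hcτ⟩ : ∃ c, 0 < c ∧ c * (T * τ ^ 2 / 6) = L + 1 + 3 * m * T :=
    ⟨(L + 1 + 3 * m * T) / (T * τ ^ 2 / 6), by positivity, div_mul_cancel₀ _ (by positivity)⟩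
  have hsweep : ∀ t ∈ Icc τ T, L + 1 + 3 * m * T ≤ c * (T * t ^ 2 / 2 - t ^ 3 / 3) :=
    fun t ht => hcτ.symm.le.trans (mul_le_mul_of_nonneg_left (le_cubic_of_mem hτ.le ht) hc.le)
  have D : SweepData L T τ m (c * (T * T)) f₀ f₀' f₁ f₁' (fun t => c * (t * (T - t)))
      (fun t => c * (T * t ^ 2 / 2 - t ^ 3 / 3)) :=
    { L_pos := hL
      T_pos := hT
      τ_pos := hτ
      two_τ_le := hτT
      m_pos := hm
      small := hτm
      hasDerivAt₀ := hd₀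
      hasDerivAt₁ := hd₁
      continuous_deriv₀ := hc₀
      continuous_deriv₁ := hc₁
      abs_le₀ := fun x => (hb₀ x).trans h₀m
      abs_le₁ := fun x => (hb₁ x).trans h₁m
      abs_deriv_le₀ := fun x => (hb₀' x).trans h₀m
      abs_deriv_le₁ := fun x => (hb₁' x).trans h₁m
      eq_zero₀ := hz₀
      eq_zero₁ := hz₁
      continuous_lam := by fun_prop
      abs_lam_le := fun t ht => by
        rw [abs_of_nonneg (mul_nonneg hc.le (mul_nonneg ht.1 (sub_nonneg.2 ht.2)))]
        exact mul_le_mul_of_nonneg_left (mul_le_mul ht.2 (by linarith [ht.1])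
          (sub_nonneg.2 ht.2) hT.le) hc.le
      hasDerivAt_primitive := fun t ht => by
        rw [clampTo_of_mem ht]
        refine (((((hasDerivAt_id' t).fun_pow 2).const_mul T).div_const 2).fun_sub
          (((hasDerivAt_id' t).fun_pow 3).div_const 3)).const_mul c |>.congr_deriv ?_
        push_cast
        ring
      sweep₀ := fun t ht => by simpa using hsweep t ht
      -- The drift is symmetric under `t ↦ T - t`, so its integral over `[t, T]` equals that over
      -- `[0, T - t]`.
      sweep₁ := fun t ht => by
        have := hsweep (T - t) ⟨by linarith [ht.2], by linarith [ht.1]⟩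
        linear_combination this }
  refine ⟨(c * (T * T) + m) + (c * T + (c * (T * T) + 3 * m) * (2 * m) + 2 * m) + c * T +
    ((c * (T * T) + m) + (c * T + (c * (T * T) + 3 * m) * (2 * m))), by positivity,
    fun α hα => ?_⟩
  obtain ⟨p, vl, vr, y, z, hp, hvl, hvr, hsol, hend, hnorm⟩ := D.exists_controlled_solution
    (lam' := fun t => c * (T - 2 * t)) (Λ' := c * T)
    (fun t => ((hasDerivAt_id' t).fun_mul ((hasDerivAt_id' t).const_sub T)).const_mul c
      |>.congr_deriv (by ring))
    (by fun_prop) (by simp) (by simp) (by fun_prop)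
    (fun t ht => by
      rw [abs_mul, abs_of_pos hc]
      exact mul_le_mul_of_nonneg_left
        (abs_le.2 ⟨by linarith [ht.2], by linarith [ht.1]⟩) hc.le) hα
  refine ⟨p, vl, vr, y, z, hp, hvl, hvr,
    hsol.congr_initial fun x hx => he₀ x (Ioo_subset_Icc_self hx),
    fun x hx => (hend x hx).trans (he₁ x (Ioo_subset_Icc_self hx)), ?_⟩
  rwa [← ENNReal.ofReal_add (by positivity) (by positivity),
    ← ENNReal.ofReal_add (by positivity) (by positivity)] at hnorm
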